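/- **Setting.** Let $q\ge 1$, $k_1,\dots,k_q\ge1$, $\lambda>0$, $0<\theta<1$, $a_i>0$ and $\lambda_{ij}>0$ ($1\le i\le q$, $1\le j\le k_i$). A Lévy process is understood to start at $0$, to have independent and stationary increments, to be stochastically continuous, and to have càdlàg paths (almost surely). Let - $M_1,\dots,M_q$ be independent generalized counting processes: $M_i$ is the $\mathbb N_0$-valued Lévy process that performs independently jumps of size $j$ at rate $\lambda_{ij}$, $1\le j\le k_i$ (so $M_i(t)$ has the law of $\sum_{j=1}^{k_i}jN_{j}$ with independent Poisson variables $N_{j}$ of mean $\lambda_{ij}t$); - $Z_1,\dots,Z_q$ be independent gamma Lévy processes, $Z_i(t)$ being gamma distributed with shape $\lambda t$ and rate $a_i$ for $t>0$; - $B^-$ be a negative binomial Lévy process with parameter $\theta$, i.e. $\Pr\{B^-(t)=n\}=(1-\theta)^t\binom{n+t-1}{n}\theta^n$ for $n\in\mathbb N_0$, independent of $(Z_1,\dots,Z_q)$. Put $G_i(t)=Z_i\big(t+\lambda^{-1}B^-(\lambda t)\big)$, $\bar G=(G_1,\dots,G_q)$, assume that $(M_1,\dots,M_q)$ is independent of $\bar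 G$, and let $\bar{\mathscr M}(t)=(\mathscr M_1(t),\dots,\mathscr M_q(t))$ with $\mathscr M_i(t)=M_i(G_i(t))$. For $\bar n\in\mathbb N_0^q$ let $p_{\bar{\mathscr M}}(\bar n,t)=\Pr\{\bar{\mathscr M}(t)=\bar n\}$. For $1\le r\le q$ and $1\le l_r\le k_r$ the hazard rate is $$R_{rl_r}(\bar n;t)=\lim_{h\to0+}\frac1h\Pr\Big(\mathscr M_r(t+h)=n_r+l_r,\ \mathscr M_i(t+h)=n_i\ (i\ne r)\,\Big|\,\bar{\mathscr M}(t)=\bar n\Big).$$ Write $\Omega(k,n)=\{(m_1,\dots,m_k)\in\mathbb N_0^k:\sum_{j}j\,m_j=n\}$, $(x)_0=1$, $(x)_m=x(x+1)\cdots(x+m-1)$, and $\lambda_i=\sum_{j=1}^{k_i}\lambda_{ij}$. **Theorem.** Let $1\le r\le q$, $1\le l_r\le k_r$, $\bar n\in\mathbb N_0^q$ and $t\ge0$, where $\bar n=\bar 0$ if $t=0$. Then $p_{\bar{\mathscr M}}(\bar n,t)>0$, the limit defining $R_{rl_r}(\bar n;t)$ exists, and $$R_{rl_r}(\bar n;t)=\frac{A(\theta,\bar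 a,t)}{p_{\bar{\mathscr M}}(\bar n,t)},$$ where $A(\theta,\bar a,t)$ is the (absolutely convergent) double series $$\begin{aligned}A(\theta,\bar a,t)=(1-\theta)^{\lambda t}\sum_{h_1=0}^\infty\sum_{h_2=0}^\infty\frac{\lambda\theta^{h_1+h_2}}{h_1!\,h_2!}&\sum_{(l_{rj})\in\Omega(k_r,l_r)}\ \sum_{\substack{(n_{ij})_{j}\in\Omega(k_i,n_i)\\ i=1,\dots,q}}\Big(\prod_{j=1}^{k_r}\frac{\lambda_{rj}^{l_{rj}}}{l_{rj}!}\Big)\Big(\prod_{i=1}^q a_i^{h_1+h_2+\lambda t}\prod_{j=1}^{k_i}\frac{\lambda_{ij}^{n_{ij}}}{n_{ij}!}\Big)\\&\cdot(a_r+\lambda_r)^{-h_1-h_2-\lambda t-\eta_r-\xi_r}\,(h_1+\xi_r-1)!\,(\lambda t)_{h_2+\eta_r}\prod_{i\ne r}(a_i+\lambda_i)^{-h_1-h_2-\lambda t-\eta_i}\,(h_2+\lambda t)_{\eta_i},\end{aligned}$$ with $\xi_r=\sum_{j=1}^{k_r}l_{rj}$ and $\eta_i=\sum_{j=1}^{k_i}n_{ij}$.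 -/

import Mathlib

open MeasureTheory ProbabilityTheory Filter Topology
open scoped NNReal ENNReal Nat

noncomputable section

namespace ShockModel

variable {Ω : Type*} [MeasurableSpace Ω]

/-- A real-valued Lévy process: it starts at `0` almost surely, has independent and stationary
increments, is stochastically continuous, and almost all of its paths are càdlàg. -/
structure IsLevyProcess (X : ℝ≥0 → Ω → ℝ) (μ : Measure Ω) : Prop where
  measurable : ∀ t, Measurable (X t)
  zero : ∀ᵐ ω ∂μ, X 0 ω = 0
  indepIncrements : HasIndepIncrements X μ
  stationaryIncrements : ∀ s t : ℝ≥0, IdentDistrib (fun ω => X (s + t) ω - X s ω) (X t) μ μ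
  continuousInProbability : ∀ s : ℝ≥0, TendstoInMeasure μ X (𝓝 s) (X s)
  cadlag : ∀ᵐ ω ∂μ, ∀ t : ℝ≥0, ContinuousWithinAt (fun s => X s ω) (Set.Ici t) t ∧
    ∃ l : ℝ, Tendsto (fun s => X s ω) (𝓝[<] t) (𝓝 l)

/-- A generalized counting process: the Lévy process which performs, independently for
`j = 0, …, k - 1`, jumps of size `j + 1` at rate `rate j`. Equivalently, `M t` is distributed as
`∑ j, (j + 1) N_j` with independent Poisson variables `N_j` of mean `rate j * t`. -/
structure IsGCP {k : ℕ} (rate : Fin k → ℝ≥0) (M : ℝ≥0 → Ω → ℕ) (μ : Measure Ω) : Prop where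
  levy : IsLevyProcess (fun t ω => (M t ω : ℝ)) μ
  law : ∀ t : ℝ≥0, HasLaw (M t)
    ((Measure.pi fun j => poissonMeasure (rate j * t)).map
      fun N : Fin k → ℕ => ∑ j : Fin k, ((j : ℕ) + 1) * N j) μ

/-- A gamma Lévy process whose value at time `t > 0` is gamma distributed with shape parameter
`lam * t` and rate parameter `a`. -/
structure IsGammaProcess (lam : ℝ≥0) (a : ℝ) (Z : ℝ≥0 → Ω → ℝ) (μ : Measure Ω) : Prop where
  levy : IsLevyProcess Z μ
  law : ∀ t : ℝ≥0, 0 < t → HasLaw (Z t) (gammaMeasure (lam * t) a) μ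

/-- The Pochhammer symbol `(x)_m = x (x + 1) ⋯ (x + m - 1)`, with `(x)_0 = 1`. -/
def poch (x : ℝ) (m : ℕ) : ℝ := (ascPochhammer ℝ m).eval x

/-- A negative binomial Lévy process with parameter `θ`; the binomial coefficient
`(n + t - 1 choose n)` of the real number `n + t - 1` is `(t)_n / n!`. -/
structure IsNegBinomialProcess (θ : ℝ) (B : ℝ≥0 → Ω → ℕ) (μ : Measure Ω) : Prop where
  levy : IsLevyProcess (fun t ω => (B t ω : ℝ)) μ
  law : ∀ (t : ℝ≥0) (n : ℕ),
    μ.real {ω | B t ω = n} = (1 - θ) ^ (t : ℝ) * (poch t n / n !) * θ ^ n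

/-- The multivariate gamma subordinator `G_i(t) = Z_i(t + B(lam t) / lam)`. -/
def gammaSub {q : ℕ} (lam : ℝ≥0) (Z : Fin q → ℝ≥0 → Ω → ℝ) (B : ℝ≥0 → Ω → ℕ)
    (i : Fin q) (t : ℝ≥0) (ω : Ω) : ℝ :=
  Z i (t + lam⁻¹ * (B (lam * t) ω : ℝ≥0)) ω

/-- The time-changed process with components `M_i(G_i(t))`. The values of a gamma process are
almost surely nonnegative, so `Real.toNNReal` only casts the new time. -/
def timeChanged {q : ℕ} (M : Fin q → ℝ≥0 → Ω → ℕ) (G : Fin q → ℝ≥0 → Ω → ℝ)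
    (i : Fin q) (t : ℝ≥0) (ω : Ω) : ℕ :=
  M i (G i t ω).toNNReal ω

/-- The probability that the process `X` is in the state `n` at time `t`. -/
def stateProb {q : ℕ} (μ : Measure Ω) (X : Fin q → ℝ≥0 → Ω → ℕ) (n : Fin q → ℕ) (t : ℝ≥0) : ℝ :=
  μ.real {ω | ∀ i, X i t ω = n i}

/-- `R` is the hazard rate of type `r` and jump size `l` in the state `n` at time `t`: the limit,
as `h → 0+`, of `1 / h` times the conditional probability, given that the state at time `t` is
`n`, that at time `t + h` the component `r` is `n r + l` and the others are unchanged. -/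
def IsHazardRate {q : ℕ} (μ : Measure Ω) (X : Fin q → ℝ≥0 → Ω → ℕ) (r : Fin q) (l : ℕ)
    (n : Fin q → ℕ) (t : ℝ≥0) (R : ℝ) : Prop :=
  Tendsto (fun h : ℝ≥0 => 1 / (h : ℝ) *
      (cond μ {ω | ∀ i, X i t ω = n i}).real
        {ω | X r (t + h) ω = n r + l ∧ ∀ i, i ≠ r → X i (t + h) ω = n i})
    (𝓝[>] 0) (𝓝 R)

/-- The index set `Ω(k, n)` of all `m` with `1 * m_1 + 2 * m_2 + ⋯ + k * m_k = n`. -/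
def partitions (k n : ℕ) : Finset (Fin k → ℕ) :=
  {m ∈ Fintype.piFinset fun _ => Finset.range (n + 1) | ∑ j : Fin k, ((j : ℕ) + 1) * m j = n}

theorem mem_partitions {k n : ℕ} {m : Fin k → ℕ} :
    m ∈ partitions k n ↔ ∑ j : Fin k, ((j : ℕ) + 1) * m j = n := by
  simp only [partitions, Finset.mem_filter, Fintype.mem_piFinset, Finset.mem_range,
    and_iff_right_iff_imp]
  intro h i
  have h1 : ((i : ℕ) + 1) * m i ≤ ∑ j : Fin k, ((j : ℕ) + 1) * m j :=
    Finset.single_le_sum (f := fun j : Fin k => ((j : ℕ) + 1) * m j)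
      (fun _ _ => Nat.zero_le _) (Finset.mem_univ i)
  nlinarith [Nat.zero_le ((i : ℕ) * m i)]

/-- The `(h₁, h₂)` term of the double series for the hazard rate. Here `ℓ` runs through
`Ω(k_r, l)`, the family `ν` through the product of the sets `Ω(k_i, n_i)`, `ξ_r = ∑ j, ℓ j`,
`η_i = ∑ j, ν i j` and `lam_i = ∑ j, rate i j`. Since `ξ_r ≥ 1` for `l ≥ 1`, the subtraction
`h₁ + ξ_r - 1` is not truncated. -/
def hazardTerm {q : ℕ} (k : Fin q → ℕ) (lam : ℝ≥0) (θ : ℝ) (a : Fin q → ℝ)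
    (rate : (i : Fin q) → Fin (k i) → ℝ≥0) (r : Fin q) (l : ℕ) (n : Fin q → ℕ) (t : ℝ≥0)
    (h₁ h₂ : ℕ) : ℝ :=
  lam * θ ^ (h₁ + h₂) / (h₁ ! * h₂ !) *
    ∑ ℓ ∈ partitions (k r) l, ∑ ν ∈ Fintype.piFinset fun i => partitions (k i) (n i),
      (∏ j, (rate r j : ℝ) ^ ℓ j / (ℓ j)!) *
      (∏ i, a i ^ ((h₁ : ℝ) + h₂ + lam * t) * ∏ j, (rate i j : ℝ) ^ ν i j / (ν i j)!) *
      (a r + ∑ j, (rate r j : ℝ)) ^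
        (-(h₁ : ℝ) - h₂ - lam * t - (∑ j, ν r j : ℕ) - (∑ j, ℓ j : ℕ)) *
      (h₁ + (∑ j, ℓ j) - 1)! * poch (lam * t) (h₂ + ∑ j, ν r j) *
      ∏ i ∈ Finset.univ.erase r,
        ((a i + ∑ j, (rate i j : ℝ)) ^ (-(h₁ : ℝ) - h₂ - lam * t - (∑ j, ν i j : ℕ)) *
          poch (h₂ + lam * t) (∑ j, ν i j))

/-- The numerator `A(θ, a, t)` of the hazard rate. -/
def hazardA {q : ℕ} (k : Fin q → ℕ) (lam : ℝ≥0) (θ : ℝ) (a : Fin q → ℝ)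
    (rate : (i : Fin q) → Fin (k i) → ℝ≥0) (r : Fin q) (l : ℕ) (n : Fin q → ℕ) (t : ℝ≥0) : ℝ :=
  (1 - θ) ^ ((lam : ℝ) * t) * ∑' h₁ : ℕ, ∑' h₂ : ℕ, hazardTerm k lam θ a rate r l n t h₁ h₂

end ShockModel

end

/-! The time-changed process has stationary increments independent of the present state: the
probability of being at `n` at time `t` and at `n + d` at time `t + h` is the product of the
probabilities of `n` at time `t` and of `d` at time `h` (`measure_timeChanged_and`). So the
conditional probability in the hazard rate is the probability of the state `l` in component `r`,
zero elsewhere, at time `h`. The hazard rate depends on neither `n` nor `t`, and the double series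
is this constant times the state probability: `h₁` carries the jump and `h₂` the state
(`hazardTerm_eq`).

For the product formula, the counting processes are first averaged out at the independent times
`G_i` (`measure_forall_gcp_comp`), by approximating these times from the right by grid points. Then
the negative binomial value and increment are frozen at `b` and `c`. The gamma processes are now
read at deterministic times, with shapes `lam * t + b` and, for the increment, `lam * h + c`, so
every factor splits. Mixing Poisson weights over a gamma law is explicit, because a gamma density
times `x ^ m * exp (-Λ x)` is again a multiple of a gamma density.

For the limit, put `x = lam * h`. A jump of size `l ≥ 1` forces `ξ ≥ 1`, and `(x)_m (x + m)_ξ = x (x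
+ 1)_{m + ξ - 1}`. This extracts the factor `x` exactly; the rest converges termwise as `x → 0`,
under a summable bound (`tendsto_tsum_jumpTerm`). -/

noncomputable section

namespace ShockModel

variable {Ω : Type*} [MeasurableSpace Ω]

/-! ### Integer-valued Lévy processes and counting processes at fixed times -/

/-- The joint law at two times of an integer-valued Lévy process. -/
theorem IsLevyProcess.measureReal_natCast_and {X : ℝ≥0 → Ω → ℕ} {μ : Measure Ω}
    (hX : IsLevyProcess (fun t ω => (X t ω : ℝ)) μ) {s t : ℝ≥0} (hst : s ≤ t) (n d : ℕ) :
    μ.real {ω | X s ω = n ∧ X t ω = n + d} =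
      μ.real {ω | X s ω = n} * μ.real {ω | X (t - s) ω = d} := by
  have hind := hX.indepIncrements.indepFun_eval_sub zero_le hst hX.zero
  have h1 : {ω | X s ω = n ∧ X t ω = n + d}
      = (fun ω => (X s ω : ℝ)) ⁻¹' {(n : ℝ)} ∩
        ((fun ω => (X t ω : ℝ)) - fun ω => (X s ω : ℝ)) ⁻¹' {(d : ℝ)} := by
    ext ω
    simp only [Set.mem_ofPred_eq, Set.mem_inter_iff, Set.mem_preimage, Set.mem_singleton_iff,
      Nat.cast_inj, Pi.sub_apply, and_congr_right_iff]
    intro h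
    rw [h, sub_eq_iff_eq_add, add_comm (d : ℝ)]
    exact_mod_cast Iff.rfl
  have h2 := hX.stationaryIncrements s (t - s)
  have h3 := h2.measure_preimage_eq (measurableSet_singleton (d : ℝ))
  rw [add_tsub_cancel_of_le hst] at h3
  have h4 : (fun ω => (X (t - s) ω : ℝ)) ⁻¹' {(d : ℝ)} = {ω | X (t - s) ω = d} := by
    ext ω
    simp
  have h5 : (fun ω => (X s ω : ℝ)) ⁻¹' {(n : ℝ)} = {ω | X s ω = n} := by
    ext ω
    simp
  rw [h1, measureReal_def, hind.measure_inter_preimage_eq_mul _ _ (measurableSet_singleton _)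
    (measurableSet_singleton _), ENNReal.toReal_mul, h5, measureReal_def, measureReal_def,
    ← h4, ← h3]
  rfl

theorem IsLevyProcess.measurable_of_natCast {X : ℝ≥0 → Ω → ℕ} {μ : Measure Ω}
    (hX : IsLevyProcess (fun t ω => (X t ω : ℝ)) μ) (t : ℝ≥0) : Measurable (X t) := by
  refine measurable_to_countable' fun n => ?_
  have h := hX.measurable t (measurableSet_singleton (n : ℝ))
  convert h using 1
  ext ω
  simp

/-- By stationarity the increment has the law of a variable with values in `ℕ`, so it is almost
surely nonnegative. -/
theorem IsLevyProcess.ae_le_of_natCast {X : ℝ≥0 → Ω → ℕ} {μ : Measure Ω}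
    (hX : IsLevyProcess (fun t ω => (X t ω : ℝ)) μ) {s t : ℝ≥0} (hst : s ≤ t) :
    ∀ᵐ ω ∂μ, X s ω ≤ X t ω := by
  have h1 := (hX.stationaryIncrements s (t - s)).symm.ae_snd (p := fun x => 0 ≤ x)
    measurableSet_Ici (Eventually.of_forall fun ω => Nat.cast_nonneg _)
  rw [add_tsub_cancel_of_le hst] at h1
  filter_upwards [h1] with ω hω using by exact_mod_cast sub_nonneg.1 hω

/-- The probability that a generalized counting process with the given rates is in the state `n`
at time `s`. -/
def gcpProb {k : ℕ} (rate : Fin k → ℝ≥0) (s : ℝ) (n : ℕ) : ℝ :=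
  ∑ ν ∈ partitions k n, ∏ j, (Real.exp (-(rate j * s)) * (rate j * s) ^ ν j / (ν j)!)

theorem continuous_gcpProb {k : ℕ} (rate : Fin k → ℝ≥0) (n : ℕ) :
    Continuous fun s => gcpProb rate s n := by
  unfold gcpProb
  fun_prop

theorem gcpProb_nonneg {k : ℕ} (rate : Fin k → ℝ≥0) {s : ℝ} (hs : 0 ≤ s) (n : ℕ) :
    0 ≤ gcpProb rate s n :=
  Finset.sum_nonneg fun _ _ => Finset.prod_nonneg fun _ _ => by positivity

theorem IsGCP.measurable {k : ℕ} {rate : Fin k → ℝ≥0} {M : ℝ≥0 → Ω → ℕ} {μ : Measure Ω}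
    (hM : IsGCP rate M μ) (t : ℝ≥0) : Measurable (M t) :=
  hM.levy.measurable_of_natCast t

theorem IsGCP.measureReal_eq {k : ℕ} {rate : Fin k → ℝ≥0} {M : ℝ≥0 → Ω → ℕ} {μ : Measure Ω}
    (hM : IsGCP rate M μ) (t : ℝ≥0) (n : ℕ) :
    μ.real {ω | M t ω = n} = gcpProb rate t n := by
  have h1 := (hM.law t).measureReal_eq (p := fun m => m = n) (measurableSet_singleton n)
  rw [h1, map_measureReal_apply (measurable_of_countable _)
    (show MeasurableSet {x | x = n} from measurableSet_singleton n)]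
  have h2 : (fun N : Fin k → ℕ => ∑ j : Fin k, ((j : ℕ) + 1) * N j) ⁻¹' {x | x = n}
      = (partitions k n : Set (Fin k → ℕ)) := by
    ext N
    simp [mem_partitions]
  rw [h2, ← sum_measureReal_singleton]
  refine Finset.sum_congr rfl fun ν _ => ?_
  rw [measureReal_def, Measure.pi_singleton, ENNReal.toReal_prod]
  refine Finset.prod_congr rfl fun j _ => ?_
  rw [← measureReal_def, poissonMeasure_real_singleton]
  push_cast
  rfl

/-- The joint law at two times of a generalized counting process. -/
theorem IsGCP.measureReal_and {k : ℕ} {rate : Fin k → ℝ≥0} {M : ℝ≥0 → Ω → ℕ} {μ : Measure Ω}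
    (hM : IsGCP rate M μ) {s t : ℝ≥0} (hst : s ≤ t) (n d : ℕ) :
    μ.real {ω | M s ω = n ∧ M t ω = n + d} = gcpProb rate s n * gcpProb rate (t - s) d := by
  rw [hM.levy.measureReal_natCast_and hst, hM.measureReal_eq, hM.measureReal_eq,
    NNReal.coe_sub hst]

theorem measure_forall_gcp {q : ℕ} {k : Fin q → ℕ} {rate : (i : Fin q) → Fin (k i) → ℝ≥0}
    {M : Fin q → ℝ≥0 → Ω → ℕ} {μ : Measure Ω} [IsProbabilityMeasure μ]
    (hM : ∀ i, IsGCP (rate i) (M i) μ) (hMindep : iIndepFun (fun i ω t => M i t ω) μ)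
    {s t : Fin q → ℝ≥0} (hst : ∀ i, s i ≤ t i) (n d : Fin q → ℕ) :
    μ {ω | ∀ i, M i (s i) ω = n i ∧ M i (t i) ω = n i + d i} =
      ENNReal.ofReal (∏ i, gcpProb (rate i) (s i) (n i) *
        gcpProb (rate i) (t i - s i) (d i)) := by
  have h1 : {ω | ∀ i, M i (s i) ω = n i ∧ M i (t i) ω = n i + d i}
      = ⋂ i, {ω | M i (s i) ω = n i ∧ M i (t i) ω = n i + d i} := by
    ext ω
    simp
  rw [h1, hMindep.meas_iInter, ENNReal.ofReal_prod_of_nonneg]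
  · refine Finset.prod_congr rfl fun i _ => ?_
    rw [← (hM i).measureReal_and (hst i), measureReal_def, ENNReal.ofReal_toReal]
    exact measure_ne_top _ _
  · intro i _
    rw [← (hM i).measureReal_and (hst i)]
    exact measureReal_nonneg
  · intro i
    refine ⟨{f | f (s i) = n i ∧ f (t i) = n i + d i}, ?_, rfl⟩
    have e1 : Measurable fun f : ℝ≥0 → ℕ => f (s i) := measurable_pi_apply _
    have e2 : Measurable fun f : ℝ≥0 → ℕ => f (t i) := measurable_pi_apply _
    exact (e1 (measurableSet_singleton (n i))).inter (e2 (measurableSet_singleton (n i + d i)))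

/-! ### Counting processes at independent random times -/

/-- Evaluation of a family of random variables at an independent countably valued index. -/
theorem lintegral_comp_countable {ι : Type*} [Countable ι] [MeasurableSpace ι]
    [MeasurableSingletonClass ι] {μ : Measure Ω} {V : Ω → ι} (hV : Measurable V)
    {F : ι → Ω → ℝ≥0∞} (hF : ∀ v, Measurable (F v)) (hind : ∀ v, IndepFun (F v) V μ) :
    ∫⁻ ω, F (V ω) ω ∂μ = ∑' v, μ (V ⁻¹' {v}) * ∫⁻ ω, F v ω ∂μ := by
  have h1 : ∀ ω, F (V ω) ω = ∑' v, (({v} : Set ι).indicator 1 (V ω)) * F v ω := by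
    intro ω
    rw [tsum_eq_single (V ω)]
    · simp
    · intro v hv
      simp [Set.indicator_of_notMem, Ne.symm hv]
  have hm : ∀ v, Measurable fun ω => ({v} : Set ι).indicator (1 : ι → ℝ≥0∞) (V ω) := fun v =>
    (measurable_one.indicator (measurableSet_singleton v)).comp hV
  simp_rw [h1]
  rw [lintegral_tsum (f := fun v ω => ({v} : Set ι).indicator (1 : ι → ℝ≥0∞) (V ω) * F v ω)
    fun v => ((hm v).mul (hF v)).aemeasurable]
  refine tsum_congr fun v => ?_
  rw [lintegral_mul_eq_lintegral_mul_lintegral_of_indepFun'' (hm v).aemeasurable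
    (hF v).aemeasurable]
  · congr 1
    have h2 : (fun ω => ({v} : Set ι).indicator (1 : ι → ℝ≥0∞) (V ω))
        = (V ⁻¹' {v}).indicator 1 := by
      ext ω
      rfl
    rw [h2, lintegral_indicator_one (hV (measurableSet_singleton v))]
  · exact ((hind v).comp measurable_id
      (measurable_one.indicator (measurableSet_singleton v))).symm

/-- Both sides have the same expansion over the values of `V`: the right side is the case of
constant functions. -/
theorem lintegral_comp_countable' {ι : Type*} [Countable ι] [MeasurableSpace ι]
    [MeasurableSingletonClass ι] {μ : Measure Ω} [IsProbabilityMeasure μ] {V : Ω → ι}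
    (hV : Measurable V)
    {F : ι → Ω → ℝ≥0∞} (hF : ∀ v, Measurable (F v)) (hind : ∀ v, IndepFun (F v) V μ) :
    ∫⁻ ω, F (V ω) ω ∂μ = ∫⁻ ω, (∫⁻ ω', F (V ω) ω' ∂μ) ∂μ := by
  rw [lintegral_comp_countable hV hF hind,
    lintegral_comp_countable (F := fun v _ => ∫⁻ ω', F v ω' ∂μ) hV (fun _ => measurable_const)
      fun v => indepFun_const_left _ _]
  simp

/-- The points of a grid of mesh `1 / (m + 1)`. -/
def gridPt (m j : ℕ) : ℝ≥0 := (j + 1) / (m + 1)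

/-- The index of the first point of the grid `gridPt m` which is greater than `x`. -/
def gridIdx (m : ℕ) (x : ℝ≥0) : ℕ := ⌊(m + 1) * x⌋₊

theorem measurable_gridIdx (m : ℕ) : Measurable (gridIdx m) :=
  Nat.measurable_floor.comp (measurable_id.const_mul _)

theorem gridPt_gridIdx_mono (m : ℕ) {x y : ℝ≥0} (h : x ≤ y) :
    gridPt m (gridIdx m x) ≤ gridPt m (gridIdx m y) := by
  unfold gridPt gridIdx
  gcongr

theorem le_gridPt_gridIdx (m : ℕ) (x : ℝ≥0) : x ≤ gridPt m (gridIdx m x) := by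
  unfold gridPt gridIdx
  rw [le_div_iff₀ (by positivity), mul_comm]
  exact (Nat.lt_floor_add_one _).le

theorem tendsto_gridPt_gridIdx (x : ℝ≥0) :
    Tendsto (fun m => gridPt m (gridIdx m x)) atTop (𝓝[≥] x) := by
  rw [tendsto_nhdsWithin_iff]
  refine ⟨?_, Eventually.of_forall fun m => le_gridPt_gridIdx m x⟩
  have h1 : Tendsto (fun m : ℕ => x + 1 / ((m : ℝ≥0) + 1)) atTop (𝓝 (x + 0)) :=
    tendsto_const_nhds.add tendsto_one_div_add_atTop_nhds_zero_nat
  rw [add_zero] at h1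
  refine tendsto_of_tendsto_of_tendsto_of_le_of_le tendsto_const_nhds h1
    (fun m => le_gridPt_gridIdx m x) fun m => ?_
  unfold gridPt gridIdx
  rw [add_div]
  gcongr
  rw [div_le_iff₀ (by positivity), mul_comm]
  exact Nat.floor_le (by positivity)

/-- The grid points approach `x` from the right, where almost all paths are continuous; convergence
in the discrete space `ℕ` means being eventually constant. -/
theorem IsGCP.ae_eventually_eq {k : ℕ} {rate : Fin k → ℝ≥0} {M : ℝ≥0 → Ω → ℕ} {μ : Measure Ω}
    (hM : IsGCP rate M μ) :
    ∀ᵐ ω ∂μ, ∀ x : ℝ≥0, ∀ᶠ m in atTop, M (gridPt m (gridIdx m x)) ω = M x ω := by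
  filter_upwards [hM.levy.cadlag] with ω hω x
  have h1 : Tendsto (fun m => (M (gridPt m (gridIdx m x)) ω : ℝ)) atTop (𝓝 (M x ω : ℝ)) :=
    (hω x).1.tendsto.comp (tendsto_gridPt_gridIdx x)
  have h2 : Tendsto (fun m => M (gridPt m (gridIdx m x)) ω) atTop (𝓝 (M x ω)) :=
    Nat.isClosedEmbedding_coe_real.isInducing.tendsto_nhds_iff.2 h1
  rwa [nhds_discrete, tendsto_pure] at h2

theorem IsGCP.measurable_comp_grid {k : ℕ} {rate : Fin k → ℝ≥0} {M : ℝ≥0 → Ω → ℕ} {μ : Measure Ω}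
    (hM : IsGCP rate M μ) {g : Ω → ℝ≥0} (hg : Measurable g) (m : ℕ) :
    Measurable fun ω => M (gridPt m (gridIdx m (g ω))) ω := by
  have h1 : Measurable (Function.uncurry fun (j : ℕ) (ω : Ω) => M (gridPt m j) ω) :=
    measurable_from_prod_countable_right fun j => hM.measurable (gridPt m j)
  have h3 : Measurable fun ω => gridIdx m (g ω) := (measurable_gridIdx m).comp hg
  have h2 : Measurable fun ω => (gridIdx m (g ω), ω) := h3.prodMk measurable_id
  have h4 := h1.comp h2
  exact h4

theorem IsGCP.aemeasurable_comp {k : ℕ} {rate : Fin k → ℝ≥0} {M : ℝ≥0 → Ω → ℕ} {μ : Measure Ω}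
    (hM : IsGCP rate M μ) {g : Ω → ℝ≥0} (hg : Measurable g) :
    AEMeasurable (fun ω => M (g ω) ω) μ := by
  refine aemeasurable_of_tendsto_metrizable_ae atTop
    (fun m => (hM.measurable_comp_grid hg m).aemeasurable) ?_
  filter_upwards [hM.ae_eventually_eq] with ω hω
  exact tendsto_const_nhds.congr' ((hω (g ω)).mono fun m h => h.symm)

/-- The law at two independent random times of independent generalized counting processes. -/
theorem measure_forall_gcp_comp {q : ℕ} {k : Fin q → ℕ} {rate : (i : Fin q) → Fin (k i) → ℝ≥0}
    {M : Fin q → ℝ≥0 → Ω → ℕ} {μ : Measure Ω} [IsProbabilityMeasure μ]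
    (hM : ∀ i, IsGCP (rate i) (M i) μ) (hMindep : iIndepFun (fun i ω t => M i t ω) μ)
    {g g' : Fin q → Ω → ℝ≥0} (hg : ∀ i, Measurable (g i)) (hg' : ∀ i, Measurable (g' i))
    (hle : ∀ᵐ ω ∂μ, ∀ i, g i ω ≤ g' i ω)
    (hind : IndepFun (fun ω i t => M i t ω) (fun ω i => (g i ω, g' i ω)) μ) (n d : Fin q → ℕ) :
    μ {ω | ∀ i, M i (g i ω) ω = n i ∧ M i (g' i ω) ω = n i + d i} =
      ∫⁻ ω, ENNReal.ofReal (∏ i, gcpProb (rate i) (g i ω) (n i) *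
        gcpProb (rate i) ((g' i ω : ℝ) - g i ω) (d i)) ∂μ := by
  set D : ℕ → ℝ≥0 → ℝ≥0 := fun m x => gridPt m (gridIdx m x) with hD
  set E : (Fin q → ℝ≥0 × ℝ≥0) → Set Ω := fun p =>
    {ω | ∀ i, M i (p i).1 ω = n i ∧ M i (p i).2 ω = n i + d i} with hE
  have hEm : ∀ p, MeasurableSet (E p) := by
    intro p
    have : E p = ⋂ i, (M i (p i).1 ⁻¹' {n i} ∩ M i (p i).2 ⁻¹' {n i + d i}) := by
      ext ω
      simp [hE]
    rw [this]
    exact MeasurableSet.iInter fun i =>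
      ((hM i).measurable _ (measurableSet_singleton _)).inter
        ((hM i).measurable _ (measurableSet_singleton _))
  set A : ℕ → Set Ω := fun m => {ω | ω ∈ E fun i => (D m (g i ω), D m (g' i ω))} with hA
  have hAm : ∀ m, MeasurableSet (A m) := by
    intro m
    have : A m = ⋂ i, ((fun ω => M i (D m (g i ω)) ω) ⁻¹' {n i} ∩
        (fun ω => M i (D m (g' i ω)) ω) ⁻¹' {n i + d i}) := by
      ext ω
      simp [hA, hE]
    rw [this]
    exact MeasurableSet.iInter fun i =>
      ((hM i).measurable_comp_grid (hg i) m (measurableSet_singleton _)).inter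
        ((hM i).measurable_comp_grid (hg' i) m (measurableSet_singleton _))
  -- Grid times take countably many values, so independence allows freezing them.
  have hAE : ∀ m, μ (A m) = ∫⁻ ω, μ (E fun i => (D m (g i ω), D m (g' i ω))) ∂μ := by
    intro m
    set V : Ω → Fin q → ℕ × ℕ := fun ω i => (gridIdx m (g i ω), gridIdx m (g' i ω)) with hV
    have hVm : Measurable V := measurable_pi_lambda _ fun i =>
      ((measurable_gridIdx m).comp (hg i)).prodMk ((measurable_gridIdx m).comp (hg' i))
    set W : (Fin q → ℕ × ℕ) → Fin q → ℝ≥0 × ℝ≥0 := fun v i =>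
      (gridPt m (v i).1, gridPt m (v i).2) with hW
    have h1 := lintegral_comp_countable' (μ := μ) (V := V) hVm
      (F := fun v => (E (W v)).indicator 1)
      (fun v => measurable_one.indicator (hEm _)) (fun v => by
        have hs : MeasurableSet {f : Fin q → ℝ≥0 → ℕ |
            ∀ i, f i (W v i).1 = n i ∧ f i (W v i).2 = n i + d i} := by
          have : {f : Fin q → ℝ≥0 → ℕ | ∀ i, f i (W v i).1 = n i ∧ f i (W v i).2 = n i + d i}
            = ⋂ i, ((fun f => f i (W v i).1) ⁻¹' {n i} ∩
              (fun f => f i (W v i).2) ⁻¹' {n i + d i}) := by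
            ext f
            simp
          rw [this]
          exact MeasurableSet.iInter fun i =>
            MeasurableSet.inter ((measurable_pi_apply _).comp (measurable_pi_apply i)
              (measurableSet_singleton _)) ((measurable_pi_apply _).comp (measurable_pi_apply i)
              (measurableSet_singleton _))
        have hs' : Measurable (Set.indicator {f : Fin q → ℝ≥0 → ℕ |
            ∀ i, f i (W v i).1 = n i ∧ f i (W v i).2 = n i + d i} (1 : (Fin q → ℝ≥0 → ℕ) → ℝ≥0∞)) :=
          measurable_one.indicator hs
        have hd : Measurable fun (p : Fin q → ℝ≥0 × ℝ≥0) i =>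
            (gridIdx m (p i).1, gridIdx m (p i).2) :=
          measurable_pi_lambda _ fun i =>
            ((measurable_gridIdx m).comp (measurable_fst.comp (measurable_pi_apply i))).prodMk
            ((measurable_gridIdx m).comp (measurable_snd.comp (measurable_pi_apply i)))
        have h2 := hind.comp hs' hd
        exact h2)
    have h3 : (fun ω => (E (W (V ω))).indicator (1 : Ω → ℝ≥0∞) ω) = (A m).indicator 1 := by
      ext ω
      simp only [Set.indicator_apply]
      rfl
    rw [← lintegral_indicator_one (hAm m), ← h3, h1]
    refine lintegral_congr fun ω => ?_
    rw [lintegral_indicator_one (hEm _)]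
  have hAE' : ∀ m, μ (A m) = ∫⁻ ω, ENNReal.ofReal (∏ i, gcpProb (rate i) (D m (g i ω)) (n i) *
        gcpProb (rate i) ((D m (g' i ω) : ℝ) - D m (g i ω)) (d i)) ∂μ := by
    intro m
    rw [hAE]
    refine lintegral_congr_ae ?_
    filter_upwards [hle] with ω hω
    exact measure_forall_gcp hM hMindep (fun i => gridPt_gridIdx_mono m (hω i)) n d
  have hlim : ∀ᵐ ω ∂μ, ∀ᶠ m in atTop,
      (ω ∈ A m ↔ ω ∈ {ω | ∀ i, M i (g i ω) ω = n i ∧ M i (g' i ω) ω = n i + d i}) := by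
    filter_upwards [ae_all_iff.2 fun i => (hM i).ae_eventually_eq] with ω hω
    filter_upwards [eventually_all.2 fun i => hω i (g i ω),
      eventually_all.2 fun i => hω i (g' i ω)] with m h1 h2
    simp only [hA, hE, Set.mem_ofPred_eq, hD, h1, h2]
  have hnull : NullMeasurableSet
      {ω | ∀ i, M i (g i ω) ω = n i ∧ M i (g' i ω) ω = n i + d i} μ := by
    have : {ω | ∀ i, M i (g i ω) ω = n i ∧ M i (g' i ω) ω = n i + d i}
      = ⋂ i, ((fun ω => M i (g i ω) ω) ⁻¹' {n i} ∩
        (fun ω => M i (g' i ω) ω) ⁻¹' {n i + d i}) := by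
      ext ω
      simp
    rw [this]
    exact NullMeasurableSet.iInter fun i =>
      (((hM i).aemeasurable_comp (hg i)).nullMeasurableSet_preimage
        (measurableSet_singleton _)).inter
      (((hM i).aemeasurable_comp (hg' i)).nullMeasurableSet_preimage (measurableSet_singleton _))
  have hl1 : Tendsto (fun m => μ (A m)) atTop
      (𝓝 (μ {ω | ∀ i, M i (g i ω) ω = n i ∧ M i (g' i ω) ω = n i + d i})) := by
    -- Only almost all paths are càdlàg, so the limit event is merely null measurable and is
    -- replaced by its measurable hull.
    have h0 := tendsto_measure_of_ae_tendsto_indicator_of_isFiniteMeasure (μ := μ) (As := A) atTop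
      (measurableSet_toMeasurable μ
        {ω | ∀ i, M i (g i ω) ω = n i ∧ M i (g' i ω) ω = n i + d i}) hAm (by
        filter_upwards [hlim, hnull.toMeasurable_ae_eq.mem_iff] with ω h1 h2
        filter_upwards [h1] with m h3
        rw [h3, h2])
    rwa [measure_toMeasurable] at h0
  refine tendsto_nhds_unique hl1 ?_
  simp_rw [hAE']
  refine tendsto_lintegral_of_dominated_convergence (fun _ => 1) ?_ ?_ (by simp) ?_
  · intro m
    have hDm : Measurable (D m) := (measurable_of_countable (gridPt m)).comp (measurable_gridIdx m)
    have hc : ∀ i n, Measurable fun s => gcpProb (rate i) s n := fun i n =>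
      (continuous_gcpProb (rate i) n).measurable
    refine ENNReal.measurable_ofReal.comp (Finset.measurable_fun_prod _ fun i _ => ?_)
    exact ((hc _ _).comp (hDm.comp (hg i)).coe_nnreal_real).mul
      ((hc _ _).comp ((hDm.comp (hg' i)).coe_nnreal_real.sub (hDm.comp (hg i)).coe_nnreal_real))
  · intro m
    filter_upwards [hle] with ω hω
    -- For fixed `ω` the integrand is itself a probability, whence the dominating constant `1`.
    rw [← measure_forall_gcp hM hMindep (fun i => gridPt_gridIdx_mono m (hω i)) n d]
    exact prob_le_one
  · refine Eventually.of_forall fun ω => ?_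
    have hd : ∀ x : ℝ≥0, Tendsto (fun m => (D m x : ℝ)) atTop (𝓝 (x : ℝ)) := fun x =>
      (NNReal.continuous_coe.tendsto x).comp
        ((tendsto_gridPt_gridIdx x).mono_right nhdsWithin_le_nhds)
    refine (ENNReal.continuous_ofReal.tendsto _).comp (tendsto_finsetProd _ fun i _ => ?_)
    exact (((continuous_gcpProb (rate i) (n i)).tendsto _).comp (hd (g i ω))).mul
      (((continuous_gcpProb (rate i) (d i)).tendsto _).comp ((hd (g' i ω)).sub (hd (g i ω))))

/-! ### Pochhammer symbols and gamma mixtures of Poisson weights -/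

theorem poch_zero_right (x : ℝ) : poch x 0 = 1 := by simp [poch]

theorem poch_succ (x : ℝ) (m : ℕ) : poch x (m + 1) = poch x m * (x + m) :=
  ascPochhammer_succ_eval m x

theorem poch_zero_left_succ (m : ℕ) : poch 0 (m + 1) = 0 := by
  induction m with
  | zero => simp [poch_succ]
  | succ m ih => rw [poch_succ, ih, zero_mul]

theorem poch_nonneg {x : ℝ} (hx : 0 ≤ x) (m : ℕ) : 0 ≤ poch x m := by
  induction m with
  | zero => simp [poch_zero_right]
  | succ m ih =>
    rw [poch_succ]
    positivity

theorem poch_pos {x : ℝ} (hx : 0 < x) (m : ℕ) : 0 < poch x m := by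
  induction m with
  | zero => simp [poch_zero_right]
  | succ m ih =>
    rw [poch_succ]
    positivity

theorem poch_add (x : ℝ) (m n : ℕ) : poch x (m + n) = poch x m * poch (x + m) n := by
  induction n with
  | zero => simp [poch_zero_right]
  | succ n ih =>
    rw [← add_assoc, poch_succ, ih, poch_succ]
    push_cast
    ring

theorem Gamma_add_nat {s : ℝ} (hs : 0 < s) (m : ℕ) :
    Real.Gamma (s + m) = poch s m * Real.Gamma s := by
  induction m with
  | zero => simp [poch_zero_right]
  | succ m ih =>
    rw [poch_succ, Nat.cast_succ, ← add_assoc, Real.Gamma_add_one (by positivity), ih]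
    ring

/-- The factor `x ^ m` raises the shape by `m`, the exponential raises the rate by `Λ`, and the
ratio of the normalizing constants is the Pochhammer symbol times the powers. -/
theorem gammaPDF_mul_pow_mul_exp {s a Λ : ℝ} (hs : 0 < s) (ha : 0 < a) (hΛ : 0 ≤ Λ) (m : ℕ)
    (x : ℝ) :
    gammaPDFReal s a x * (x ^ m * Real.exp (-(Λ * x))) =
      poch s m * (a ^ s * (a + Λ) ^ (-s - m)) * gammaPDFReal (s + m) (a + Λ) x := by
  unfold gammaPDFReal
  split_ifs with hx
  · have haΛ : 0 < a + Λ := by positivity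
    have h1 : x ^ (s - 1) * x ^ m = x ^ (s + m - 1) := by
      -- At `x = 0` with `m ≥ 1` both sides vanish, since `s + m - 1 > 0`; for `m = 0` nothing
      -- changes.
      rcases hx.eq_or_lt with rfl | hx
      · rcases Nat.eq_zero_or_pos m with rfl | hm
        · simp
        · have : (1 : ℝ) ≤ m := by exact_mod_cast hm
          have h0 : s + m - 1 ≠ 0 := by linarith
          rw [zero_pow hm.ne', Real.zero_rpow h0, mul_zero]
      · rw [← Real.rpow_natCast, ← Real.rpow_add hx]
        congr 1
        ring
    have h2 : Real.exp (-(a * x)) * Real.exp (-(Λ * x)) = Real.exp (-((a + Λ) * x)) := by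
      rw [← Real.exp_add]
      congr 1
      ring
    have h3 : (a + Λ) ^ (-s - m) * (a + Λ) ^ (s + m) = 1 := by
      rw [← Real.rpow_add haΛ]
      simp
    have h4 : Real.Gamma s ≠ 0 := (Real.Gamma_pos_of_pos hs).ne'
    have h5 : poch s m ≠ 0 := (poch_pos hs m).ne'
    rw [Gamma_add_nat hs, ← h1, ← h2]
    field_simp
    linear_combination (-(x ^ (s - 1) * x ^ m)) * h3
  · simp

theorem ae_gammaMeasure_nonneg (s a : ℝ) : ∀ᵐ x ∂gammaMeasure s a, 0 ≤ x := by
  rw [ae_iff]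
  have : {x : ℝ | ¬ 0 ≤ x} = Set.Iio 0 := by
    ext x
    simp
  rw [this, gammaMeasure, withDensity_apply _ measurableSet_Iio,
    lintegral_gammaPDF_of_nonpos le_rfl]

theorem lintegral_pow_mul_exp_gammaMeasure {s a Λ : ℝ} (hs : 0 < s) (ha : 0 < a) (hΛ : 0 ≤ Λ)
    (m : ℕ) :
    ∫⁻ x, ENNReal.ofReal (x ^ m * Real.exp (-(Λ * x))) ∂gammaMeasure s a =
      ENNReal.ofReal (poch s m * (a ^ s * (a + Λ) ^ (-s - m))) := by
  have haΛ : 0 < a + Λ := by positivity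
  have hc : 0 ≤ poch s m * (a ^ s * (a + Λ) ^ (-s - m)) :=
    mul_nonneg (poch_nonneg hs.le m) (by positivity)
  rw [gammaMeasure, lintegral_withDensity_eq_lintegral_mul _
    (show Measurable (gammaPDF s a) from (measurable_gammaPDFReal s a).ennreal_ofReal)
    (by fun_prop)]
  have h1 : ∀ x, (gammaPDF s a * fun x => ENNReal.ofReal (x ^ m * Real.exp (-(Λ * x)))) x =
      ENNReal.ofReal (poch s m * (a ^ s * (a + Λ) ^ (-s - m))) * gammaPDF (s + m) (a + Λ) x := by
    intro x
    rw [Pi.mul_apply, gammaPDF, gammaPDF, ← ENNReal.ofReal_mul (gammaPDFReal_nonneg hs ha x),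
      ← ENNReal.ofReal_mul hc, gammaPDF_mul_pow_mul_exp hs ha hΛ]
  simp_rw [h1]
  rw [lintegral_const_mul' _ _ ENNReal.ofReal_ne_top,
    lintegral_gammaPDF_eq_one (by positivity) haΛ, mul_one]

/-- The probability that a generalized counting process is in the state `n` at an independent
gamma distributed time with shape `s` and rate `a`. -/
def mixProb {k : ℕ} (rate : Fin k → ℝ≥0) (a s : ℝ) (n : ℕ) : ℝ :=
  ∑ ν ∈ partitions k n, (∏ j, (rate j : ℝ) ^ ν j / (ν j)!) *
    (poch s (∑ j, ν j) * (a ^ s * (a + ∑ j, (rate j : ℝ)) ^ (-s - (∑ j, ν j : ℕ))))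

theorem mixProb_nonneg {k : ℕ} (rate : Fin k → ℝ≥0) {a s : ℝ} (ha : 0 < a) (hs : 0 ≤ s) (n : ℕ) :
    0 ≤ mixProb rate a s n :=
  Finset.sum_nonneg fun ν _ => mul_nonneg (by positivity)
    (mul_nonneg (poch_nonneg hs _) (by positivity))

theorem gcpProb_eq {k : ℕ} (rate : Fin k → ℝ≥0) (x : ℝ) (n : ℕ) :
    gcpProb rate x n = ∑ ν ∈ partitions k n, (∏ j, (rate j : ℝ) ^ ν j / (ν j)!) *
      (x ^ (∑ j, ν j) * Real.exp (-((∑ j, (rate j : ℝ)) * x))) := by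
  refine Finset.sum_congr rfl fun ν _ => ?_
  rw [Finset.sum_mul, ← Finset.sum_neg_distrib, Real.exp_sum, ← Finset.prod_pow_eq_pow_sum,
    ← Finset.prod_mul_distrib, ← Finset.prod_mul_distrib]
  refine Finset.prod_congr rfl fun j _ => ?_
  rw [mul_pow]
  ring

/-- There is no gamma law of shape `0`, but `(0)_m = 0` for `m ≥ 1` makes the mixture formula agree
with evaluation at time `0`. This covers `t = 0` below. -/
theorem gcpProb_zero_eq_mixProb {k : ℕ} (rate : Fin k → ℝ≥0) (a : ℝ) (n : ℕ) :
    gcpProb rate 0 n = mixProb rate a 0 n := by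
  rw [gcpProb_eq]
  refine Finset.sum_congr rfl fun ν _ => ?_
  rcases h : ∑ j, ν j with _ | m
  · simp [poch_zero_right]
  · simp [poch_zero_left_succ]

theorem lintegral_gcpProb_gammaMeasure {k : ℕ} (rate : Fin k → ℝ≥0) {s a : ℝ} (hs : 0 < s)
    (ha : 0 < a) (n : ℕ) :
    ∫⁻ x, ENNReal.ofReal (gcpProb rate x n) ∂gammaMeasure s a =
      ENNReal.ofReal (mixProb rate a s n) := by
  have hC : ∀ ν : Fin k → ℕ, 0 ≤ ∏ j, (rate j : ℝ) ^ ν j / (ν j)! := fun ν => by positivity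
  have h1 : ∫⁻ x, ENNReal.ofReal (gcpProb rate x n) ∂gammaMeasure s a =
      ∫⁻ x, ∑ ν ∈ partitions k n, ENNReal.ofReal (∏ j, (rate j : ℝ) ^ ν j / (ν j)!) *
        ENNReal.ofReal (x ^ (∑ j, ν j) * Real.exp (-((∑ j, (rate j : ℝ)) * x)))
        ∂gammaMeasure s a := by
    refine lintegral_congr_ae ?_
    filter_upwards [ae_gammaMeasure_nonneg s a] with x hx
    rw [gcpProb_eq, ENNReal.ofReal_sum_of_nonneg fun ν _ => by positivity]
    exact Finset.sum_congr rfl fun ν _ => ENNReal.ofReal_mul (hC ν)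
  rw [h1, lintegral_finsetSum _ fun ν _ => by fun_prop, mixProb,
    ENNReal.ofReal_sum_of_nonneg fun ν _ => mul_nonneg (hC ν)
      (mul_nonneg (poch_nonneg hs.le _) (by positivity))]
  refine Finset.sum_congr rfl fun ν _ => ?_
  rw [lintegral_const_mul' _ _ ENNReal.ofReal_ne_top,
    lintegral_pow_mul_exp_gammaMeasure hs ha (by positivity), ENNReal.ofReal_mul (hC ν)]

/-! ### Averaging over the gamma processes -/

section GammaProcess

variable {lam : ℝ≥0} {a : ℝ} {Z : ℝ≥0 → Ω → ℝ} {μ : Measure Ω}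

theorem IsGammaProcess.ae_nonneg (hZ : IsGammaProcess lam a Z μ) (t : ℝ≥0) :
    ∀ᵐ ω ∂μ, 0 ≤ Z t ω := by
  rcases (zero_le (a := t)).eq_or_lt with rfl | ht
  · filter_upwards [hZ.levy.zero] with ω hω using hω.ge
  · exact ((hZ.law t ht).ae_iff (p := fun x => 0 ≤ x) (by fun_prop)).2 (ae_gammaMeasure_nonneg _ _)

theorem IsGammaProcess.ae_le (hZ : IsGammaProcess lam a Z μ) {s t : ℝ≥0} (hst : s ≤ t) :
    ∀ᵐ ω ∂μ, Z s ω ≤ Z t ω := by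
  have h1 := (hZ.levy.stationaryIncrements s (t - s)).symm.ae_snd (p := fun x => 0 ≤ x)
    measurableSet_Ici (hZ.ae_nonneg (t - s))
  rw [add_tsub_cancel_of_le hst] at h1
  filter_upwards [h1] with ω hω using sub_nonneg.1 hω

theorem IsGammaProcess.lintegral_gcpProb {k : ℕ} (rate : Fin k → ℝ≥0) [IsProbabilityMeasure μ]
    (hZ : IsGammaProcess lam a Z μ) (hlam : 0 < lam) (ha : 0 < a) (t : ℝ≥0) (n : ℕ) :
    ∫⁻ ω, ENNReal.ofReal (gcpProb rate (Z t ω) n) ∂μ =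
      ENNReal.ofReal (mixProb rate a (lam * t) n) := by
  rcases (zero_le (a := t)).eq_or_lt with rfl | ht
  · rw [NNReal.coe_zero, mul_zero, ← gcpProb_zero_eq_mixProb,
      lintegral_congr_ae (g := fun _ => ENNReal.ofReal (gcpProb rate 0 n))]
    · simp
    · filter_upwards [hZ.levy.zero] with ω hω
      rw [hω]
  · rw [(hZ.law t ht).lintegral_comp (f := fun x => ENNReal.ofReal (gcpProb rate x n))
      (continuous_gcpProb rate n).measurable.ennreal_ofReal.aemeasurable,
      lintegral_gcpProb_gammaMeasure rate (by positivity) ha]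

theorem IsGammaProcess.lintegral_gcpProb_mul {k : ℕ} (rate : Fin k → ℝ≥0)
    [IsProbabilityMeasure μ]
    (hZ : IsGammaProcess lam a Z μ) (hlam : 0 < lam) (ha : 0 < a) {s t : ℝ≥0} (hst : s ≤ t)
    (n d : ℕ) :
    ∫⁻ ω, ENNReal.ofReal (gcpProb rate (Z s ω) n * gcpProb rate (Z t ω - Z s ω) d) ∂μ =
      ENNReal.ofReal (mixProb rate a (lam * s) n) *
        ENNReal.ofReal (mixProb rate a (lam * (t - s)) d) := by
  have hm : ∀ n, Measurable fun x => ENNReal.ofReal (gcpProb rate x n) := fun n =>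
    (continuous_gcpProb rate n).measurable.ennreal_ofReal
  have h1 : ∫⁻ ω, ENNReal.ofReal (gcpProb rate (Z s ω) n * gcpProb rate (Z t ω - Z s ω) d) ∂μ =
      ∫⁻ ω, ENNReal.ofReal (gcpProb rate (Z s ω) n) *
        ENNReal.ofReal (gcpProb rate (Z t ω - Z s ω) d) ∂μ := by
    refine lintegral_congr_ae ?_
    filter_upwards [hZ.ae_nonneg s] with ω hω
    exact ENNReal.ofReal_mul (gcpProb_nonneg rate hω n)
  have hind := hZ.levy.indepIncrements.indepFun_eval_sub zero_le hst hZ.levy.zero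
  have h2 := hind.comp (hm n) (hm d)
  have h3 := (((hZ.levy.stationaryIncrements s (t - s)).comp (hm d)).lintegral_eq)
  rw [add_tsub_cancel_of_le hst] at h3
  have h4 : ∫⁻ ω, ENNReal.ofReal (gcpProb rate (Z t ω - Z s ω) d) ∂μ =
      ENNReal.ofReal (mixProb rate a (lam * (t - s)) d) := by
    rw [← NNReal.coe_sub hst, ← hZ.lintegral_gcpProb rate hlam ha]
    exact h3
  rw [h1, ← hZ.lintegral_gcpProb rate hlam ha, ← h4]
  exact lintegral_mul_eq_lintegral_mul_lintegral_of_indepFun''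
    ((hm n).comp (hZ.levy.measurable s)).aemeasurable
    ((hm d).comp ((hZ.levy.measurable t).sub (hZ.levy.measurable s))).aemeasurable h2

end GammaProcess

theorem lintegral_prod_gcpProb {q : ℕ} {k : Fin q → ℕ} (rate : (i : Fin q) → Fin (k i) → ℝ≥0)
    {lam : ℝ≥0} (hlam : 0 < lam) {a : Fin q → ℝ} (ha : ∀ i, 0 < a i) {Z : Fin q → ℝ≥0 → Ω → ℝ}
    {μ : Measure Ω} [IsProbabilityMeasure μ] (hZ : ∀ i, IsGammaProcess lam (a i) (Z i) μ)
    (hZindep : iIndepFun (fun i ω t => Z i t ω) μ) {s t : ℝ≥0} (hst : s ≤ t)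
    (n d : Fin q → ℕ) :
    ∫⁻ ω, ENNReal.ofReal (∏ i, gcpProb (rate i) (Z i s ω) (n i) *
        gcpProb (rate i) (Z i t ω - Z i s ω) (d i)) ∂μ =
      (∏ i, ENNReal.ofReal (mixProb (rate i) (a i) (lam * s) (n i))) *
        ∏ i, ENNReal.ofReal (mixProb (rate i) (a i) (lam * (t - s)) (d i)) := by
  have hm : ∀ i, Measurable fun z : ℝ≥0 → ℝ => ENNReal.ofReal
      (gcpProb (rate i) (z s) (n i) * gcpProb (rate i) (z t - z s) (d i)) := fun i =>
    (((continuous_gcpProb (rate i) (n i)).measurable.comp (measurable_pi_apply s)).mul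
      ((continuous_gcpProb (rate i) (d i)).measurable.comp
        ((measurable_pi_apply t).sub (measurable_pi_apply s)))).ennreal_ofReal
  have hZm : ∀ i, Measurable fun ω t => Z i t ω := fun i =>
    measurable_pi_lambda _ (hZ i).levy.measurable
  rw [← Finset.prod_mul_distrib, ← Finset.prod_congr rfl fun i _ =>
    (hZ i).lintegral_gcpProb_mul (rate i) hlam (ha i) hst (n i) (d i)]
  have h1 := lintegral_prod_eq_prod_lintegral_of_indepFun Finset.univ _ (hZindep.comp _ hm)
    fun i => (hm i).comp (hZm i)
  refine Eq.trans (lintegral_congr_ae ?_) h1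
  filter_upwards [ae_all_iff.2 fun i => (hZ i).ae_nonneg s,
    ae_all_iff.2 fun i => (hZ i).ae_le hst] with ω hω1 hω2
  rw [ENNReal.ofReal_prod_of_nonneg]
  · rfl
  · exact fun i _ => mul_nonneg (gcpProb_nonneg _ (hω1 i) _)
      (gcpProb_nonneg _ (sub_nonneg.2 (hω2 i)) _)

/-! ### The joint law of the time-changed process at two times -/

section JointLaw

variable {q : ℕ} {k : Fin q → ℕ} {rate : (i : Fin q) → Fin (k i) → ℝ≥0} {lam : ℝ≥0} {θ : ℝ}
  {a : Fin q → ℝ} {M : Fin q → ℝ≥0 → Ω → ℕ} {Z : Fin q → ℝ≥0 → Ω → ℝ} {B : ℝ≥0 → Ω → ℕ}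
  {μ : Measure Ω}

/-- The probability that the time-changed process is in the state `n` at time `t` while the
negative binomial process is in the state `b`. -/
def stateTerm {q : ℕ} {k : Fin q → ℕ} (rate : (i : Fin q) → Fin (k i) → ℝ≥0) (lam : ℝ≥0) (θ : ℝ)
    (a : Fin q → ℝ) (n : Fin q → ℕ) (t : ℝ≥0) (b : ℕ) : ℝ :=
  (1 - θ) ^ ((lam : ℝ) * t) * (poch (lam * t) b / b !) * θ ^ b *
    ∏ i, mixProb (rate i) (a i) (lam * t + b) (n i)

theorem stateTerm_nonneg (hθ0 : 0 < θ) (hθ1 : θ < 1) (ha : ∀ i, 0 < a i) (n : Fin q → ℕ)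
    (t : ℝ≥0) (b : ℕ) : 0 ≤ stateTerm rate lam θ a n t b := by
  have h1 : 0 < 1 - θ := by linarith
  have h2 := poch_nonneg (x := lam * t) (by positivity) b
  exact mul_nonneg (by positivity)
    (Finset.prod_nonneg fun i _ => mixProb_nonneg _ (ha i) (by positivity) _)

theorem ofReal_stateTerm (hθ0 : 0 < θ) (hθ1 : θ < 1) (ha : ∀ i, 0 < a i) (n : Fin q → ℕ)
    (t : ℝ≥0) (b : ℕ) :
    ENNReal.ofReal (stateTerm rate lam θ a n t b) =
      ENNReal.ofReal ((1 - θ) ^ ((lam : ℝ) * t) * (poch (lam * t) b / b !) * θ ^ b) *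
        ∏ i, ENNReal.ofReal (mixProb (rate i) (a i) (lam * t + b) (n i)) := by
  have h1 : 0 < 1 - θ := by linarith
  have h2 := poch_nonneg (x := lam * t) (by positivity) b
  rw [stateTerm, ENNReal.ofReal_mul (by positivity),
    ENNReal.ofReal_prod_of_nonneg fun i _ => mixProb_nonneg _ (ha i) (by positivity) _]

theorem measurable_gammaSub (hZ : ∀ i, IsGammaProcess lam (a i) (Z i) μ)
    (hB : IsNegBinomialProcess θ B μ) (i : Fin q) (t : ℝ≥0) :
    Measurable (gammaSub lam Z B i t) := by
  have h1 : Measurable (Function.uncurry fun (b : ℕ) (ω : Ω) => Z i (t + lam⁻¹ * (b : ℝ≥0)) ω) :=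
    measurable_from_prod_countable_right fun b =>
      (hZ i).levy.measurable (t + lam⁻¹ * (b : ℝ≥0))
  have h2 : Measurable fun ω => (B (lam * t) ω, ω) :=
    (hB.levy.measurable_of_natCast (lam * t)).prodMk measurable_id
  have h3 := h1.comp h2
  exact h3

theorem IsNegBinomialProcess.measure_increment [IsProbabilityMeasure μ]
    (hθ0 : 0 < θ) (hθ1 : θ < 1) (hB : IsNegBinomialProcess θ B μ) {s t : ℝ≥0} (hst : s ≤ t)
    (b c : ℕ) :
    μ ((fun ω => (B s ω, B t ω - B s ω)) ⁻¹' {(b, c)}) =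
      ENNReal.ofReal ((1 - θ) ^ (s : ℝ) * (poch s b / b !) * θ ^ b) *
        ENNReal.ofReal ((1 - θ) ^ ((t : ℝ) - s) * (poch (t - s) c / c !) * θ ^ c) := by
  have h1 : μ ((fun ω => (B s ω, B t ω - B s ω)) ⁻¹' {(b, c)}) =
      -- Monotonicity makes the truncated subtraction a true difference almost surely.
      μ {ω | B s ω = b ∧ B t ω = b + c} := by
    refine measure_congr ?_
    filter_upwards [hB.levy.ae_le_of_natCast hst] with ω hω
    refine propext ?_
    change ((B s ω, B t ω - B s ω) = (b, c)) ↔ (B s ω = b ∧ B t ω = b + c)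
    rw [Prod.mk.injEq]
    omega
  rw [h1, ← ENNReal.ofReal_toReal (measure_ne_top μ {ω | B s ω = b ∧ B t ω = b + c}),
    ← measureReal_def, hB.levy.measureReal_natCast_and hst, hB.law, hB.law, NNReal.coe_sub hst,
    ENNReal.ofReal_mul]
  have h2 : 0 < 1 - θ := by linarith
  have h3 := poch_nonneg s.2 b
  positivity

/-- The law of the multivariate time-changed process at two times: it has independent
and stationary increments. -/
theorem measure_timeChanged_and [IsProbabilityMeasure μ]
    (hlam : 0 < lam) (hθ0 : 0 < θ) (hθ1 : θ < 1) (ha : ∀ i, 0 < a i)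
    (hM : ∀ i, IsGCP (rate i) (M i) μ) (hZ : ∀ i, IsGammaProcess lam (a i) (Z i) μ)
    (hB : IsNegBinomialProcess θ B μ) (hMindep : iIndepFun (fun i ω t => M i t ω) μ)
    (hZindep : iIndepFun (fun i ω t => Z i t ω) μ)
    (hZB : IndepFun (fun ω i t => Z i t ω) (fun ω t => B t ω) μ)
    (hMG : IndepFun (fun ω i t => M i t ω) (fun ω i t => gammaSub lam Z B i t ω) μ)
    (n d : Fin q → ℕ) (t h : ℝ≥0) :
    μ {ω | ∀ i, timeChanged M (gammaSub lam Z B) i t ω = n i ∧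
        timeChanged M (gammaSub lam Z B) i (t + h) ω = n i + d i} =
      (∑' b, ENNReal.ofReal (stateTerm rate lam θ a n t b)) *
        ∑' c, ENNReal.ofReal (stateTerm rate lam θ a d h c) := by
  have hGm := fun i t => measurable_gammaSub hZ hB i t
  have hs : ∀ b c : ℕ, t + lam⁻¹ * (b : ℝ≥0) ≤ t + h + lam⁻¹ * ((b + c : ℕ) : ℝ≥0) := by
    intro b c
    push_cast
    rw [mul_add]
    gcongr
    · exact le_self_add
    · exact le_self_add
  have hst : lam * t ≤ lam * (t + h) := by
    gcongr
    exact le_self_add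
  -- The times at which `Z i` is read are random but indexed by countably many `b` and `c`, so a
  -- single null set suffices for all of them.
  have hG : ∀ᵐ ω ∂μ, ∀ i, 0 ≤ gammaSub lam Z B i t ω ∧
      gammaSub lam Z B i t ω ≤ gammaSub lam Z B i (t + h) ω := by
    filter_upwards [hB.levy.ae_le_of_natCast hst,
      ae_all_iff.2 fun i => ae_all_iff.2 fun b : ℕ => (hZ i).ae_nonneg (t + lam⁻¹ * (b : ℝ≥0)),
      ae_all_iff.2 fun i => ae_all_iff.2 fun b : ℕ => ae_all_iff.2 fun c : ℕ =>
        (hZ i).ae_le (hs b c)] with ω h1 h2 h3 i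
    refine ⟨h2 i _, ?_⟩
    have h4 := h3 i (B (lam * t) ω) (B (lam * (t + h)) ω - B (lam * t) ω)
    rwa [add_tsub_cancel_of_le h1] at h4
  have hpath : Measurable fun (p : Fin q → ℝ≥0 → ℝ) i =>
      ((p i t).toNNReal, (p i (t + h)).toNNReal) :=
    measurable_pi_lambda _ fun i =>
      ((measurable_pi_apply t).comp (measurable_pi_apply i)).real_toNNReal.prodMk
        ((measurable_pi_apply (t + h)).comp (measurable_pi_apply i)).real_toNNReal
  have h1 := measure_forall_gcp_comp hM hMindep
    (g := fun i ω => (gammaSub lam Z B i t ω).toNNReal)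
    (g' := fun i ω => (gammaSub lam Z B i (t + h) ω).toNNReal)
    (fun i => (hGm i t).real_toNNReal) (fun i => (hGm i (t + h)).real_toNNReal)
    (by
      filter_upwards [hG] with ω hω i
      exact Real.toNNReal_le_toNNReal (hω i).2)
    (hMG.comp measurable_id hpath) n d
  refine h1.trans ?_
  -- `V` is the only randomness of the times at which the `Z i` are read, and it is independent of
  -- `Z`.
  set V : Ω → ℕ × ℕ := fun ω => (B (lam * t) ω, B (lam * (t + h)) ω - B (lam * t) ω) with hV
  have hVm : Measurable V :=
    (hB.levy.measurable_of_natCast (lam * t)).prodMk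
      ((hB.levy.measurable_of_natCast (lam * (t + h))).sub
        (hB.levy.measurable_of_natCast (lam * t)))
  set H : ℕ × ℕ → (Fin q → ℝ≥0 → ℝ) → ℝ≥0∞ := fun v z =>
    ENNReal.ofReal (∏ i, gcpProb (rate i) (z i (t + lam⁻¹ * (v.1 : ℝ≥0))) (n i) *
      gcpProb (rate i) (z i (t + h + lam⁻¹ * ((v.1 + v.2 : ℕ) : ℝ≥0)) -
        z i (t + lam⁻¹ * (v.1 : ℝ≥0))) (d i)) with hH
  have hHm : ∀ v, Measurable (H v) := by
    intro v
    have hz : ∀ i (s : ℝ≥0), Measurable fun z : Fin q → ℝ≥0 → ℝ => z i s := fun i s =>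
      (measurable_pi_apply s).comp (measurable_pi_apply i)
    refine ENNReal.measurable_ofReal.comp (Finset.measurable_fun_prod _ fun i _ => ?_)
    exact ((continuous_gcpProb (rate i) (n i)).measurable.comp (hz i _)).mul
      ((continuous_gcpProb (rate i) (d i)).measurable.comp ((hz i _).sub (hz i _)))
  have hZm : Measurable fun ω i t => Z i t ω :=
    measurable_pi_lambda _ fun i => measurable_pi_lambda _ (hZ i).levy.measurable
  have hBV : Measurable fun β : ℝ≥0 → ℕ => (β (lam * t), β (lam * (t + h)) - β (lam * t)) :=
    (measurable_pi_apply (lam * t)).prodMk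
      ((measurable_pi_apply (lam * (t + h))).sub (measurable_pi_apply (lam * t)))
  have hFm : ∀ v, Measurable fun ω => H v fun i t => Z i t ω := by
    intro v
    have h2 := (hHm v).comp hZm
    exact h2
  have hFV : ∀ v, IndepFun (fun ω => H v fun i t => Z i t ω) V μ := by
    intro v
    have h2 := hZB.comp (hHm v) hBV
    exact h2
  have h2 := lintegral_comp_countable (μ := μ) hVm hFm hFV
  refine (lintegral_congr_ae ?_).trans (h2.trans ?_)
  · filter_upwards [hB.levy.ae_le_of_natCast hst, hG] with ω h3 h4
    simp only [hH, hV, add_tsub_cancel_of_le h3]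
    congr 1
    refine Finset.prod_congr rfl fun i _ => ?_
    rw [Real.coe_toNNReal _ (h4 i).1, Real.coe_toNNReal _ ((h4 i).1.trans (h4 i).2)]
    rfl
  · have h3 : ∀ v : ℕ × ℕ, μ (V ⁻¹' {v}) * ∫⁻ ω, H v (fun i t => Z i t ω) ∂μ =
        ENNReal.ofReal (stateTerm rate lam θ a n t v.1) *
          ENNReal.ofReal (stateTerm rate lam θ a d h v.2) := by
      rintro ⟨b, c⟩
      have hl : (lam : ℝ) ≠ 0 := by positivity
      have e1 : (lam : ℝ) * ((t + lam⁻¹ * (b : ℝ≥0) : ℝ≥0) : ℝ) = lam * t + b := by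
        push_cast
        field_simp
      have e2 : (lam : ℝ) * (((t + h + lam⁻¹ * ((b + c : ℕ) : ℝ≥0) : ℝ≥0) : ℝ) -
          ((t + lam⁻¹ * (b : ℝ≥0) : ℝ≥0) : ℝ)) = lam * h + c := by
        push_cast
        field_simp
        ring
      have e3 : (((lam * (t + h) : ℝ≥0) : ℝ) - ((lam * t : ℝ≥0) : ℝ)) = lam * h := by
        push_cast
        ring
      have h4 := lintegral_prod_gcpProb rate hlam ha hZ hZindep (hs b c) n d
      rw [e1, e2] at h4
      rw [hV, hB.measure_increment hθ0 hθ1 hst, h4, e3, ofReal_stateTerm hθ0 hθ1 ha,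
        ofReal_stateTerm hθ0 hθ1 ha, NNReal.coe_mul]
      ring
    simp_rw [h3]
    rw [ENNReal.tsum_prod' , ← ENNReal.tsum_mul_right]
    simp_rw [ENNReal.tsum_mul_left]

end JointLaw

/-! ### Positivity and elementary bounds -/

theorem mixProb_zero_right {k : ℕ} (rate : Fin k → ℝ≥0) (a s : ℝ) :
    mixProb rate a s 0 = a ^ s * (a + ∑ j, (rate j : ℝ)) ^ (-s) := by
  have h1 : partitions k 0 = {0} := by
    ext m
    rw [mem_partitions, Finset.mem_singleton, Finset.sum_eq_zero_iff, funext_iff]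
    simp
  simp [mixProb, h1, poch_zero_right]

theorem mixProb_pos {k : ℕ} (hk : 1 ≤ k) (rate : Fin k → ℝ≥0) (hrate : ∀ j, 0 < rate j)
    {a s : ℝ} (ha : 0 < a) (hs : 0 < s) (n : ℕ) : 0 < mixProb rate a s n := by
  -- The witness realizes the state `n` by `n` jumps of size one.
  refine Finset.sum_pos (fun ν _ => mul_pos (Finset.prod_pos fun j _ => ?_)
    (mul_pos (poch_pos hs _) (by positivity))) ⟨Pi.single ⟨0, hk⟩ n, ?_⟩
  · have := hrate j
    positivity
  · rw [mem_partitions, Finset.sum_eq_single ⟨0, hk⟩]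
    · simp
    · intro j _ hj
      simp [Pi.single_eq_of_ne hj]
    · simp

theorem rpow_mul_rpow_neg_le_one {a Λ s : ℝ} (ha : 0 < a) (hΛ : 0 ≤ Λ) (hs : 0 ≤ s) :
    a ^ s * (a + Λ) ^ (-s) ≤ 1 := by
  rw [Real.rpow_neg (by positivity), ← div_eq_mul_inv, div_le_one (by positivity)]
  exact Real.rpow_le_rpow ha.le (by linarith) hs

theorem poch_one (m : ℕ) : poch 1 m = m ! := by
  induction m with
  | zero => simp [poch_zero_right]
  | succ m ih =>
    rw [poch_succ, ih, Nat.factorial_succ]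
    push_cast
    ring

theorem poch_succ_left (x : ℝ) (m : ℕ) : poch x (m + 1) = x * poch (x + 1) m := by
  rw [add_comm m 1, poch_add, poch_succ, poch_zero_right]
  simp

theorem poch_mono {x y : ℝ} (hx : 0 ≤ x) (hxy : x ≤ y) (m : ℕ) : poch x m ≤ poch y m := by
  induction m with
  | zero => simp [poch_zero_right]
  | succ m ih =>
    rw [poch_succ, poch_succ]
    have := poch_nonneg hx m
    have := poch_nonneg (hx.trans hxy) m
    gcongr

theorem continuous_poch (m : ℕ) : Continuous fun x => poch x m :=
  (ascPochhammer ℝ m).continuous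

theorem poch_add_one_le {x : ℝ} (hx0 : 0 ≤ x) (hx1 : x ≤ 1) (m : ℕ) :
    poch (x + 1) m ≤ (m + 1)! := by
  have h1 : poch (1 + 1) m = (m + 1)! := by
    rw [← poch_one, poch_succ_left, one_mul]
  rw [← h1]
  exact poch_mono (by linarith) (by linarith) m

/-! ### A single jump in a short time -/

section JumpTerm

variable {q : ℕ} {k : Fin q → ℕ} {rate : (i : Fin q) → Fin (k i) → ℝ≥0} {lam : ℝ≥0} {θ : ℝ}
  {a : Fin q → ℝ} {r : Fin q} {l : ℕ}

/-- The probability of a jump of size `l` of the component `r` alone, while the negative binomial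
process moves from `0` to `m` during a time interval of length `x`, divided by `x`. -/
def jumpTerm {q : ℕ} {k : Fin q → ℕ} (rate : (i : Fin q) → Fin (k i) → ℝ≥0) (θ : ℝ)
    (a : Fin q → ℝ) (r : Fin q) (l : ℕ) (m : ℕ) (x : ℝ) : ℝ :=
  (1 - θ) ^ x * (θ ^ m / m !) *
    (∑ ℓ ∈ partitions (k r) l, (∏ j, (rate r j : ℝ) ^ ℓ j / (ℓ j)!) *
      (poch (x + 1) (m + (∑ j, ℓ j) - 1) *
        (a r ^ (x + m) * (a r + ∑ j, (rate r j : ℝ)) ^ (-(x + m) - (∑ j, ℓ j : ℕ))))) *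
    ∏ i ∈ Finset.univ.erase r, (a i ^ (x + m) * (a i + ∑ j, (rate i j : ℝ)) ^ (-(x + m)))

theorem one_le_sum_of_mem_partitions {k l : ℕ} (hl : 1 ≤ l) {ℓ : Fin k → ℕ}
    (hℓ : ℓ ∈ partitions k l) : 1 ≤ ∑ j, ℓ j := by
  by_contra! h
  have h0 : ∀ j, ℓ j = 0 := by
    have : ∑ j, ℓ j = 0 := by omega
    simpa using this
  rw [mem_partitions] at hℓ
  simp only [h0, mul_zero, Finset.sum_const_zero] at hℓ
  omega

/-- Since `ξ ≥ 1`, `(x)_m (x + m)_ξ = (x)_{m + ξ}` contains the factor `x = lam * h`. What is left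
still makes sense at `x = 0`. -/
theorem stateTerm_single (hl : 1 ≤ l) (h : ℝ≥0) (m : ℕ) :
    stateTerm rate lam θ a (Pi.single r l) h m =
      (lam * h) * jumpTerm rate θ a r l m (lam * h) := by
  have h1 : ∏ i, mixProb (rate i) (a i) (lam * h + m) ((Pi.single r l : Fin q → ℕ) i) =
      mixProb (rate r) (a r) (lam * h + m) l * ∏ i ∈ Finset.univ.erase r,
        (a i ^ ((lam : ℝ) * h + m) * (a i + ∑ j, (rate i j : ℝ)) ^ (-((lam : ℝ) * h + m))) := by
    rw [← Finset.mul_prod_erase _ _ (Finset.mem_univ r), Pi.single_eq_same]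
    congr 1
    refine Finset.prod_congr rfl fun i hi => ?_
    rw [Pi.single_eq_of_ne (Finset.ne_of_mem_erase hi), mixProb_zero_right]
  have h2 : poch (lam * h) m * mixProb (rate r) (a r) (lam * h + m) l =
      (lam * h) * ∑ ℓ ∈ partitions (k r) l, (∏ j, (rate r j : ℝ) ^ ℓ j / (ℓ j)!) *
      (poch (lam * h + 1) (m + (∑ j, ℓ j) - 1) * (a r ^ ((lam : ℝ) * h + m) *
        (a r + ∑ j, (rate r j : ℝ)) ^ (-((lam : ℝ) * h + m) - (∑ j, ℓ j : ℕ)))) := by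
    rw [mixProb, Finset.mul_sum, Finset.mul_sum]
    refine Finset.sum_congr rfl fun ℓ hℓ => ?_
    have h3 := one_le_sum_of_mem_partitions hl hℓ
    have h4 := poch_add (lam * h) m (∑ j, ℓ j)
    have h5 : m + ∑ j, ℓ j = (m + ∑ j, ℓ j - 1) + 1 := by omega
    rw [h5, poch_succ_left] at h4
    linear_combination (-(∏ j, (rate r j : ℝ) ^ ℓ j / (ℓ j)!) * (a r ^ ((lam : ℝ) * h + m) *
        (a r + ∑ j, (rate r j : ℝ)) ^ (-((lam : ℝ) * h + m) - (∑ j, ℓ j : ℕ)))) * h4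
  rw [stateTerm, h1, jumpTerm]
  linear_combination ((1 - θ) ^ ((lam : ℝ) * h) * (θ ^ m / m !) * ∏ i ∈ Finset.univ.erase r,
    (a i ^ ((lam : ℝ) * h + m) * (a i + ∑ j, (rate i j : ℝ)) ^ (-((lam : ℝ) * h + m)))) * h2

theorem continuous_jumpTerm (hθ1 : θ < 1) (ha : ∀ i, 0 < a i) (m : ℕ) :
    Continuous (jumpTerm rate θ a r l m) := by
  have h1 : 1 - θ ≠ 0 := by linarith
  have h2 : ∀ i, a i ≠ 0 := fun i => (ha i).ne'
  have h3 : ∀ i, a i + ∑ j, (rate i j : ℝ) ≠ 0 := fun i => by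
    have := ha i
    positivity
  have hc : ∀ c : ℝ, c ≠ 0 → ∀ f : ℝ → ℝ, Continuous f → Continuous fun x => c ^ f x :=
    fun c hc f hf => (Real.continuous_const_rpow hc).comp hf
  unfold jumpTerm
  refine ((hc _ h1 _ continuous_id).mul continuous_const).mul
    (continuous_finsetSum _ fun ℓ _ => continuous_const.mul
      (((continuous_poch _).comp (by fun_prop)).mul ((hc _ (h2 r) _ (by fun_prop)).mul
        (hc _ (h3 r) _ (by fun_prop))))) |>.mul (continuous_finsetProd _ fun i _ =>
      (hc _ (h2 i) _ (by fun_prop)).mul (hc _ (h3 i) _ (by fun_prop)))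

theorem jumpTerm_nonneg (hθ0 : 0 < θ) (hθ1 : θ < 1) (ha : ∀ i, 0 < a i) {x : ℝ} (hx : 0 ≤ x)
    (m : ℕ) : 0 ≤ jumpTerm rate θ a r l m x := by
  have h1 : 0 < 1 - θ := by linarith
  have h2 : ∀ i, 0 ≤ a i := fun i => (ha i).le
  refine mul_nonneg (mul_nonneg (by positivity) (Finset.sum_nonneg fun ℓ _ => ?_))
    (Finset.prod_nonneg fun i _ => ?_)
  · have h3 := poch_nonneg (x := x + 1) (by linarith) (m + (∑ j, ℓ j) - 1)
    have := h2 r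
    positivity
  · have := h2 i
    positivity

/-- A summable bound for the terms `jumpTerm`. -/
def jumpBound {q : ℕ} {k : Fin q → ℕ} (rate : (i : Fin q) → Fin (k i) → ℝ≥0) (θ : ℝ)
    (a : Fin q → ℝ) (r : Fin q) (l : ℕ) (m : ℕ) : ℝ :=
  ∑ ℓ ∈ partitions (k r) l, (∏ j, (rate r j : ℝ) ^ ℓ j / (ℓ j)!) *
    (a r + ∑ j, (rate r j : ℝ)) ^ (-((∑ j, ℓ j : ℕ) : ℝ)) *
    ((m + ∑ j, ℓ j)! / m ! * θ ^ m)

theorem summable_jumpBound (hθ0 : 0 < θ) (hθ1 : θ < 1) :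
    Summable (jumpBound rate θ a r l) := by
  refine summable_sum fun ℓ _ => Summable.mul_left _ ?_
  have h1 : ‖θ‖ < 1 := by rwa [Real.norm_of_nonneg hθ0.le]
  -- `(m + ξ)! / m!` is `ξ!` times a binomial coefficient.
  have h2 := (summable_choose_mul_geometric_of_norm_lt_one (∑ j, ℓ j) h1).mul_left
    (((∑ j, ℓ j)! : ℕ) : ℝ)
  refine h2.congr fun m => ?_
  have h3 : ((m + ∑ j, ℓ j).choose (∑ j, ℓ j) * (∑ j, ℓ j)! * m ! : ℝ) = (m + ∑ j, ℓ j)! := by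
    have := Nat.choose_mul_factorial_mul_factorial (Nat.le_add_left (∑ j, ℓ j) m)
    rw [Nat.add_sub_cancel] at this
    exact_mod_cast this
  rw [← h3]
  field_simp

/-- For `0 ≤ x ≤ 1`, `(x + 1)_{m + ξ - 1} ≤ (2)_{m + ξ - 1} = (m + ξ)!`, while `(1 - θ) ^ x` and
each `(a / (a + Λ)) ^ (x + m)` are at most `1`. -/
theorem jumpTerm_le_jumpBound (hθ0 : 0 < θ) (hθ1 : θ < 1) (ha : ∀ i, 0 < a i) (hl : 1 ≤ l)
    {x : ℝ} (hx0 : 0 ≤ x) (hx1 : x ≤ 1) (m : ℕ) :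
    jumpTerm rate θ a r l m x ≤ jumpBound rate θ a r l m := by
  have h1 : 0 < 1 - θ := by linarith
  have hp : 0 ≤ x + m := by positivity
  have har := ha r
  have haΛ : 0 < a r + ∑ j, (rate r j : ℝ) := by positivity
  have h2 : (1 - θ) ^ x ≤ 1 := Real.rpow_le_one h1.le (by linarith) hx0
  have h3 : ∏ i ∈ Finset.univ.erase r,
      (a i ^ (x + m) * (a i + ∑ j, (rate i j : ℝ)) ^ (-(x + m))) ≤ 1 := by
    refine Finset.prod_le_one (fun i _ => ?_) fun i _ =>
      rpow_mul_rpow_neg_le_one (ha i) (by positivity) hp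
    have := ha i
    positivity
  have h4 : ∀ ℓ ∈ partitions (k r) l, poch (x + 1) (m + (∑ j, ℓ j) - 1) *
        (a r ^ (x + m) * (a r + ∑ j, (rate r j : ℝ)) ^ (-(x + m) - (∑ j, ℓ j : ℕ))) ≤
      (m + ∑ j, ℓ j)! * (a r + ∑ j, (rate r j : ℝ)) ^ (-((∑ j, ℓ j : ℕ) : ℝ)) := by
    intro ℓ hℓ
    have h5 := poch_add_one_le hx0 hx1 (m + (∑ j, ℓ j) - 1)
    have h6 := one_le_sum_of_mem_partitions hl hℓ
    rw [show m + (∑ j, ℓ j) - 1 + 1 = m + ∑ j, ℓ j by omega] at h5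
    rw [sub_eq_add_neg (-(x + m)), Real.rpow_add haΛ, ← mul_assoc (a r ^ (x + m))]
    have h7 := rpow_mul_rpow_neg_le_one har
      (show 0 ≤ ∑ j, (rate r j : ℝ) by positivity) hp
    exact mul_le_mul h5 (mul_le_of_le_one_left (by positivity) h7) (by positivity)
      (by positivity)
  have h8 : ∀ ℓ : Fin (k r) → ℕ, 0 ≤ poch (x + 1) (m + (∑ j, ℓ j) - 1) *
      (a r ^ (x + m) * (a r + ∑ j, (rate r j : ℝ)) ^ (-(x + m) - (∑ j, ℓ j : ℕ))) := fun ℓ =>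
    mul_nonneg (poch_nonneg (by linarith) _) (by positivity)
  have h9 : 0 ≤ ∑ ℓ ∈ partitions (k r) l, (∏ j, (rate r j : ℝ) ^ ℓ j / (ℓ j)!) *
      (poch (x + 1) (m + (∑ j, ℓ j) - 1) *
        (a r ^ (x + m) * (a r + ∑ j, (rate r j : ℝ)) ^ (-(x + m) - (∑ j, ℓ j : ℕ)))) :=
    Finset.sum_nonneg fun ℓ _ => mul_nonneg (by positivity) (h8 ℓ)
  unfold jumpTerm jumpBound
  refine (mul_le_of_le_one_right (mul_nonneg (by positivity) h9) h3).trans ?_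
  refine (mul_le_mul_of_nonneg_right
    (mul_le_of_le_one_left (by positivity) h2) h9).trans ?_
  rw [Finset.mul_sum]
  refine Finset.sum_le_sum fun ℓ hℓ => ?_
  calc θ ^ m / m ! * ((∏ j, (rate r j : ℝ) ^ ℓ j / (ℓ j)!) *
        (poch (x + 1) (m + (∑ j, ℓ j) - 1) *
        (a r ^ (x + m) * (a r + ∑ j, (rate r j : ℝ)) ^ (-(x + m) - (∑ j, ℓ j : ℕ)))))
      ≤ θ ^ m / m ! * ((∏ j, (rate r j : ℝ) ^ ℓ j / (ℓ j)!) *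
        ((m + ∑ j, ℓ j)! * (a r + ∑ j, (rate r j : ℝ)) ^ (-((∑ j, ℓ j : ℕ) : ℝ)))) := by
        exact mul_le_mul_of_nonneg_left (mul_le_mul_of_nonneg_left (h4 ℓ hℓ) (by positivity))
          (by positivity)
    _ = _ := by ring

theorem tendsto_tsum_jumpTerm (hθ0 : 0 < θ) (hθ1 : θ < 1) (ha : ∀ i, 0 < a i) (hl : 1 ≤ l)
    (lam : ℝ≥0) :
    Tendsto (fun h : ℝ≥0 => ∑' m, jumpTerm rate θ a r l m (lam * h)) (𝓝[>] 0)
      (𝓝 (∑' m, jumpTerm rate θ a r l m 0)) := by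
  have hx : Tendsto (fun h : ℝ≥0 => (lam : ℝ) * h) (𝓝[>] 0) (𝓝 0) := by
    have : Continuous fun h : ℝ≥0 => (lam : ℝ) * h := by fun_prop
    have h1 := this.tendsto 0
    rw [NNReal.coe_zero, mul_zero] at h1
    exact h1.mono_left nhdsWithin_le_nhds
  refine tendsto_tsum_of_dominated_convergence
    (summable_jumpBound (rate := rate) (a := a) (r := r) (l := l) hθ0 hθ1)
    (fun m => ((continuous_jumpTerm hθ1 ha m).tendsto 0).comp hx) ?_
  filter_upwards [hx.eventually (Iio_mem_nhds one_pos)] with h h1 m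
  have h2 : (0 : ℝ) ≤ lam * h := by positivity
  rw [Real.norm_of_nonneg (jumpTerm_nonneg hθ0 hθ1 ha h2 m)]
  exact jumpTerm_le_jumpBound hθ0 hθ1 ha hl h2 (le_of_lt h1) m

theorem summable_jumpTerm (hθ0 : 0 < θ) (hθ1 : θ < 1) (ha : ∀ i, 0 < a i) (hl : 1 ≤ l) :
    Summable fun m => jumpTerm rate θ a r l m 0 :=
  (summable_jumpBound hθ0 hθ1).of_nonneg_of_le (fun m => jumpTerm_nonneg hθ0 hθ1 ha le_rfl m)
    fun m => jumpTerm_le_jumpBound hθ0 hθ1 ha hl le_rfl zero_le_one m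

/-- The terms of the double series for the hazard rate factorize. -/
theorem hazardTerm_eq (ha : ∀ i, 0 < a i) (n : Fin q → ℕ) (t : ℝ≥0) (h₁ h₂ : ℕ) :
    (1 - θ) ^ ((lam : ℝ) * t) * hazardTerm k lam θ a rate r l n t h₁ h₂ =
      lam * jumpTerm rate θ a r l h₁ 0 * stateTerm rate lam θ a n t h₂ := by
  have hrp : ∀ i (x y : ℝ), a i ^ (x + y) = a i ^ x * a i ^ y := fun i x y =>
    Real.rpow_add (ha i) x y
  have hrq : ∀ i (x y : ℝ), (a i + ∑ j, (rate i j : ℝ)) ^ (x + y) =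
      (a i + ∑ j, (rate i j : ℝ)) ^ x * (a i + ∑ j, (rate i j : ℝ)) ^ y := fun i x y => by
    have := ha i
    exact Real.rpow_add (by positivity) x y
  have e1 : (h₁ : ℝ) + h₂ + lam * t = h₁ + (lam * t + h₂) := by ring
  have e2 : ∀ y : ℝ, -(h₁ : ℝ) - h₂ - lam * t - y = -(h₁ : ℝ) + (-(lam * t + h₂) - y) := fun y => by
    ring
  have e3 : ∀ y z : ℝ, -(h₁ : ℝ) + y - z = (-(h₁ : ℝ) - z) + y := fun y z => by ring
  have e4 : (h₂ : ℝ) + lam * t = lam * t + h₂ := add_comm _ _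
  have hprod : ∀ f : Fin q → ℝ, ∏ i, f i = f r * ∏ i ∈ Finset.univ.erase r, f i := fun f =>
    (Finset.mul_prod_erase _ f (Finset.mem_univ r)).symm
  rw [hazardTerm, jumpTerm, stateTerm]
  -- At `x = 0` the symbol `(1)_{h₁ + ξ - 1}` becomes the factorial of the series.
  simp only [mixProb, zero_add, Real.rpow_zero, one_mul, poch_one, e1, e2, e3, hrp, hrq]
  rw [Finset.prod_univ_sum]
  simp only [Finset.sum_mul, Finset.mul_sum]
  rw [Finset.sum_comm]
  refine Finset.sum_congr rfl fun ν _ => Finset.sum_congr rfl fun ℓ _ => ?_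
  -- In the series, component `r` carries `(lam * t)_{h₂ + η_r}`: its own factor `(lam * t +
  -- h₂)_{η_r}` merged with the negative binomial weight `(lam * t)_{h₂}`.
  simp only [hprod, e4, poch_add, Finset.prod_mul_distrib, pow_add]
  ring

end JumpTerm

/-! ### Time zero and positivity of the state probability -/

theorem stateTerm_zero_zero {q : ℕ} {k : Fin q → ℕ} (rate : (i : Fin q) → Fin (k i) → ℝ≥0)
    (lam : ℝ≥0) (θ : ℝ) (a : Fin q → ℝ) (b : ℕ) :
    stateTerm rate lam θ a 0 0 b = if b = 0 then 1 else 0 := by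
  rcases b with _ | b
  · simp [stateTerm, mixProb_zero_right, poch_zero_right]
  · simp [stateTerm, poch_zero_left_succ]

theorem stateTerm_zero_pos {q : ℕ} {k : Fin q → ℕ} (hk : ∀ i, 1 ≤ k i)
    {rate : (i : Fin q) → Fin (k i) → ℝ≥0} (hrate : ∀ i j, 0 < rate i j)
    {lam : ℝ≥0} (hlam : 0 < lam) {θ : ℝ} (hθ1 : θ < 1) {a : Fin q → ℝ} (ha : ∀ i, 0 < a i)
    {n : Fin q → ℕ} {t : ℝ≥0} (hnt : 0 < t ∨ n = 0) : 0 < stateTerm rate lam θ a n t 0 := by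
  have h1 : 0 < 1 - θ := by linarith
  rw [stateTerm, poch_zero_right]
  refine mul_pos (by positivity) (Finset.prod_pos fun i _ => ?_)
  rcases hnt with ht | rfl
  · exact mixProb_pos (hk i) _ (hrate i) (ha i) (by positivity) _
  · have := ha i
    rw [Pi.zero_apply, mixProb_zero_right]
    positivity

end ShockModel

end

/-! ### The hazard rate -/

open ShockModel

theorem mainTheorem8 {Ω : Type*} [MeasurableSpace Ω] (μ : Measure Ω) [IsProbabilityMeasure μ]
    (q : ℕ) (k : Fin q → ℕ) (hk : ∀ i, 1 ≤ k i)
    (lam : ℝ≥0) (hlam : 0 < lam) (θ : ℝ) (hθ0 : 0 < θ) (hθ1 : θ < 1)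
    (a : Fin q → ℝ) (ha : ∀ i, 0 < a i)
    (rate : (i : Fin q) → Fin (k i) → ℝ≥0) (hrate : ∀ i j, 0 < rate i j)
    (M : Fin q → ℝ≥0 → Ω → ℕ) (Z : Fin q → ℝ≥0 → Ω → ℝ) (B : ℝ≥0 → Ω → ℕ)
    (hM : ∀ i, ShockModel.IsGCP (rate i) (M i) μ)
    (hZ : ∀ i, ShockModel.IsGammaProcess lam (a i) (Z i) μ)
    (hB : ShockModel.IsNegBinomialProcess θ B μ)
    (hMindep : iIndepFun (fun i ω t => M i t ω) μ)
    (hZindep : iIndepFun (fun i ω t => Z i t ω) μ)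
    (hZB : IndepFun (fun ω i t => Z i t ω) (fun ω t => B t ω) μ)
    (hMG : IndepFun (fun ω i t => M i t ω) (fun ω i t => ShockModel.gammaSub lam Z B i t ω) μ)
    (r : Fin q) (l : ℕ) (hl1 : 1 ≤ l) (hlk : l ≤ k r) (n : Fin q → ℕ) (t : ℝ≥0)
    (hnt : 0 < t ∨ n = 0) :
    0 < ShockModel.stateProb μ (ShockModel.timeChanged M (ShockModel.gammaSub lam Z B)) n t ∧
    Summable (fun h : ℕ × ℕ => ShockModel.hazardTerm k lam θ a rate r l n t h.1 h.2) ∧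
    ShockModel.IsHazardRate μ (ShockModel.timeChanged M (ShockModel.gammaSub lam Z B)) r l n t
      (ShockModel.hazardA k lam θ a rate r l n t /
        ShockModel.stateProb μ (ShockModel.timeChanged M (ShockModel.gammaSub lam Z B)) n t) := by
  set X := timeChanged M (gammaSub lam Z B) with hX
  have hθ : 0 < (1 - θ) ^ ((lam : ℝ) * t) := Real.rpow_pos_of_pos (by linarith) _
  have hjoint := measure_timeChanged_and hlam hθ0 hθ1 ha hM hZ hB hMindep hZindep hZB hMG
  have hstate : ∀ (n : Fin q → ℕ) (t : ℝ≥0), μ {ω | ∀ i, X i t ω = n i} =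
      ∑' b, ENNReal.ofReal (stateTerm rate lam θ a n t b) := by
    intro n t
    -- The marginal law is the joint law with `h = 0` and `d = 0`, whose second factor is `1`.
    have h1 := hjoint n 0 t 0
    simp only [add_zero, Pi.zero_apply, and_self] at h1
    rw [h1]
    simp_rw [stateTerm_zero_zero]
    rw [tsum_eq_single (f := fun c : ℕ => ENNReal.ofReal (if c = 0 then 1 else 0)) 0
      (fun c hc => by simp [hc])]
    simp
  have hsum : ∀ (n : Fin q → ℕ) (t : ℝ≥0), Summable (stateTerm rate lam θ a n t) := by
    intro n t
    -- The series sums to a probability, so it is finite.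
    have h1 : ∑' b, ENNReal.ofReal (stateTerm rate lam θ a n t b) ≠ ⊤ := by
      rw [← hstate]
      exact measure_ne_top _ _
    refine (ENNReal.summable_toReal h1).congr fun b => ?_
    rw [ENNReal.toReal_ofReal (stateTerm_nonneg hθ0 hθ1 ha n t b)]
  have htsum : ∀ (n : Fin q → ℕ) (t : ℝ≥0),
      ∑' b, ENNReal.ofReal (stateTerm rate lam θ a n t b) =
        ENNReal.ofReal (∑' b, stateTerm rate lam θ a n t b) := fun n t =>
    (ENNReal.ofReal_tsum_of_nonneg (stateTerm_nonneg hθ0 hθ1 ha n t) (hsum n t)).symm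
  have hnonneg : ∀ (n : Fin q → ℕ) (t : ℝ≥0), 0 ≤ ∑' b, stateTerm rate lam θ a n t b :=
    fun n t => tsum_nonneg (stateTerm_nonneg hθ0 hθ1 ha n t)
  have hprob : stateProb μ X n t = ∑' b, stateTerm rate lam θ a n t b := by
    rw [stateProb, measureReal_def, hstate, htsum, ENNReal.toReal_ofReal (hnonneg n t)]
  have hpos : 0 < ∑' b, stateTerm rate lam θ a n t b :=
    (hsum n t).tsum_pos (stateTerm_nonneg hθ0 hθ1 ha n t) 0
      (stateTerm_zero_pos hk hrate hlam hθ1 ha hnt)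
  have hterm : ∀ h₁ h₂, hazardTerm k lam θ a rate r l n t h₁ h₂ =
      ((1 - θ) ^ ((lam : ℝ) * t))⁻¹ * (lam * jumpTerm rate θ a r l h₁ 0 *
        stateTerm rate lam θ a n t h₂) := by
    intro h₁ h₂
    rw [← hazardTerm_eq ha, inv_mul_cancel_left₀ hθ.ne']
  have hA : hazardA k lam θ a rate r l n t / stateProb μ X n t =
      lam * ∑' m, jumpTerm rate θ a r l m 0 := by
    rw [hprob, div_eq_iff hpos.ne', hazardA]
    simp_rw [hterm, tsum_mul_left, tsum_mul_right]
    rw [tsum_mul_left, mul_inv_cancel_left₀ hθ.ne']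
  refine ⟨hprob ▸ hpos, ?_, ?_⟩
  · simp_rw [hterm]
    refine Summable.mul_left _ (Summable.mul_of_nonneg
      ((summable_jumpTerm hθ0 hθ1 ha hl1).mul_left _) (hsum n t) (fun m => ?_)
      (stateTerm_nonneg hθ0 hθ1 ha n t))
    exact mul_nonneg lam.2 (jumpTerm_nonneg hθ0 hθ1 ha le_rfl m)
  · rw [hA, IsHazardRate]
    have hXm : ∀ i, AEMeasurable (X i t) μ := fun i =>
      (hM i).aemeasurable_comp (measurable_gammaSub hZ hB i t).real_toNNReal
    have hnull : NullMeasurableSet {ω | ∀ i, X i t ω = n i} μ := by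
      have : {ω | ∀ i, X i t ω = n i} = ⋂ i, X i t ⁻¹' {n i} := by
        ext ω
        simp
      rw [this]
      exact NullMeasurableSet.iInter fun i =>
        (hXm i).nullMeasurableSet_preimage (measurableSet_singleton _)
    -- The state probability at time `t` cancels, so neither `n` nor `t` appears on the right.
    have hcond : ∀ h : ℝ≥0, (cond μ {ω | ∀ i, X i t ω = n i}).real
        {ω | X r (t + h) ω = n r + l ∧ ∀ i, i ≠ r → X i (t + h) ω = n i} =
        ∑' m, stateTerm rate lam θ a (Pi.single r l) h m := by
      intro h
      have h1 : {ω | X r (t + h) ω = n r + l ∧ ∀ i, i ≠ r → X i (t + h) ω = n i} ∩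
          {ω | ∀ i, X i t ω = n i} = {ω | ∀ i, X i t ω = n i ∧
            X i (t + h) ω = n i + (Pi.single r l : Fin q → ℕ) i} := by
        ext ω
        simp only [Set.mem_inter_iff, Set.mem_ofPred_eq]
        constructor
        · rintro ⟨⟨h2, h3⟩, h4⟩ i
          refine ⟨h4 i, ?_⟩
          rcases eq_or_ne i r with rfl | hi
          · rw [h2, Pi.single_eq_same]
          · rw [h3 i hi, Pi.single_eq_of_ne hi, add_zero]
        · intro h2
          refine ⟨⟨?_, fun i hi => ?_⟩, fun i => (h2 i).1⟩
          · rw [(h2 r).2, Pi.single_eq_same]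
          · rw [(h2 i).2, Pi.single_eq_of_ne hi, add_zero]
      rw [ProbabilityTheory.cond, measureReal_ennreal_smul_apply, measureReal_def,
        Measure.restrict_apply₀' hnull, h1, hjoint, hstate, htsum, htsum, ENNReal.toReal_mul,
        ENNReal.toReal_inv, ENNReal.toReal_ofReal hpos.le, ENNReal.toReal_ofReal (hnonneg _ _),
        inv_mul_cancel_left₀ hpos.ne']
    refine ((tendsto_tsum_jumpTerm (rate := rate) (r := r) hθ0 hθ1 ha hl1 lam).const_mul
      (lam : ℝ)).congr' ?_
    filter_upwards [self_mem_nhdsWithin] with h hh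
    have hh0 : (h : ℝ) ≠ 0 := by
      have : 0 < h := hh
      positivity
    rw [hcond]
    simp_rw [stateTerm_single hl1]
    rw [tsum_mul_left]
    field_simp
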